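/- Let $F$ be a field containing a field $\mathbf{k}$ (an arbitrary ground field), with finite transcendence degree $n\ge 1$ over $\mathbf{k}$. For a graded $\mathbf{k}$-subalgebra $A\subset F[t]$ (that is, $A=\bigoplus_{k\ge 0}A_k$ with $A_k=L_kt^k$ for $\mathbf{k}$-subspaces $L_k\subset F$) let $H_A(k)=\dim_{\mathbf{k}}A_k$ be its Hilbert function and let $m(A)$ be the index in $\mathbb{Z}$ of the subgroup generated by $\{k\ge 0 : A_k\neq 0\}$. For a non-zero finite dimensional $\mathbf{k}$-subspace $L\subset F$ put $A_L=\bigoplus_{k\ge 0}L^kt^k$, where $L^0=\mathbf{k}$ and, for $k>0$, $L^k$ is the span of all products of $k$ elements of $L$. A graded subalgebra of $F[t]$ is of integral type if it is a finitely generated module over some such $A_L$, and of almost integral type if it is contained in a graded subalgebra of integral type. Let $A_1,A_2\subset F[t]$ be algebras of almost integral type with $m(A_1)=m(A_2)=1$, and let $A_3=A_1A_2$ be their componentwise product, i.e. the graded subalgebra whose $k$-th homogeneous component is $(L'_kL''_k)t^k$, where $L'_kt^k$ and $L''_kt^k$ are the $k$-th homogeneous components of $A_1$ and $A_2$ and $L'_kL''_k$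 is the $\mathbf{k}$-span of all products $fg$ with $f\in L'_k$, $g\in L''_k$. Then the $n$-th growth coefficients $$\rho_i=\lim_{k\to\infty}\frac{H_{A_i}(k)}{k^n}\qquad(i=1,2,3)$$ exist as finite non-negative real numbers, and $$\rho_1^{1/n}+\rho_2^{1/n}\le\rho_3^{1/n}.$$ -/

import Mathlib

/-! Graded `𝕜`-subspaces and graded `𝕜`-subalgebras of the polynomial ring `F[t]`, where `F` is a
field containing the ground field `𝕜`. -/

namespace GradedPoly

variable {𝕜 F : Type*} [Field 𝕜] [Field F] [Algebra 𝕜 F]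

/-- The `𝕜`-linear map `F → F[t]`, `a ↦ a t ^ i`. -/
noncomputable def homogeneous (𝕜 : Type*) {F : Type*} [Field 𝕜] [Field F] [Algebra 𝕜 F] (i : ℕ) :
    F →ₗ[𝕜] Polynomial F :=
  (Polynomial.monomial i : F →ₗ[F] Polynomial F).restrictScalars 𝕜

/-- The `i`-th homogeneous component `M_i` of `M`: the elements of `M` of the form `a t ^ i`. -/
noncomputable def component (M : Submodule 𝕜 (Polynomial F)) (i : ℕ) :
    Submodule 𝕜 (Polynomial F) :=
  M ⊓ LinearMap.range (homogeneous 𝕜 i)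

/-- The `i`-th subspace `L_i` of `M`: those `a ∈ F` with `a t ^ i ∈ M`. -/
noncomputable def subspace (M : Submodule 𝕜 (Polynomial F)) (i : ℕ) : Submodule 𝕜 F :=
  M.comap (homogeneous 𝕜 i)

/-- `M` is graded: it contains the homogeneous parts of each of its elements, i.e. it is the direct
sum of its homogeneous components. -/
def IsGraded (M : Submodule 𝕜 (Polynomial F)) : Prop :=
  ∀ f ∈ M, ∀ i : ℕ, Polynomial.monomial i (f.coeff i) ∈ M

/-- The Hilbert function `H_M(i) = dim_𝕜 M_i`, with value `∞` if `M_i` is infinite dimensional. -/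
noncomputable def hilbertFunction (M : Submodule 𝕜 (Polynomial F)) (i : ℕ) : ℕ∞ :=
  Cardinal.toENat (Module.rank 𝕜 (component M i))

/-- The algebra `A_L = ⨁ L ^ i t ^ i`. Here `L ^ 0 = 𝕜`, and for `i > 0` the space `L ^ i` is
spanned by the products of `i` elements of `L`. -/
def powerAlgebra (L : Submodule 𝕜 F) : Subalgebra 𝕜 (Polynomial F) where
  carrier := {f | ∀ i, f.coeff i ∈ L ^ i}
  mul_mem' {f g} hf hg i := by
    rw [Polynomial.coeff_mul]
    refine Submodule.sum_mem _ fun x hx => ?_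
    rw [← Finset.HasAntidiagonal.mem_antidiagonal.mp hx, pow_add]
    exact Submodule.mul_mem_mul (hf _) (hg _)
  add_mem' {f g} hf hg i := by
    rw [Polynomial.coeff_add]
    exact Submodule.add_mem _ (hf i) (hg i)
  algebraMap_mem' r i := by
    rw [Polynomial.algebraMap_apply, Polynomial.coeff_C]
    split_ifs with h
    · subst h
      rw [pow_zero]
      exact Submodule.algebraMap_mem r
    · exact Submodule.zero_mem _

/-- `A` is an algebra of integral type: a graded subalgebra that is a finitely generated module
over (contains, and is finite over) `A_L` for some non-zero finite dimensional `L`. -/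
def IsIntegralType (A : Subalgebra 𝕜 (Polynomial F)) : Prop :=
  IsGraded (Subalgebra.toSubmodule A) ∧
    ∃ L : Submodule 𝕜 F, L ≠ ⊥ ∧ FiniteDimensional 𝕜 L ∧
      ∃ h : powerAlgebra L ≤ A, (Subalgebra.inclusion h).Finite

/-- `A` is an algebra of almost integral type: a graded subalgebra that is contained in an algebra
of integral type. -/
def IsAlmostIntegralType (A : Subalgebra 𝕜 (Polynomial F)) : Prop :=
  IsGraded (Subalgebra.toSubmodule A) ∧
    ∃ A' : Subalgebra 𝕜 (Polynomial F), IsIntegralType A' ∧ A ≤ A'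

/-- `m(A)`: the index in `ℤ` of the subgroup generated by the degrees `i` with `A_i ≠ 0` (with the
convention that an infinite index is `0`). -/
noncomputable def levelIndex (A : Subalgebra 𝕜 (Polynomial F)) : ℕ :=
  (AddSubgroup.closure
    ((fun i : ℕ => (i : ℤ)) '' {i | component (Subalgebra.toSubmodule A) i ≠ ⊥})).index

/-- The componentwise product of graded algebras: its `i`-th subspace is the span `L'_i L''_i` of
the products of an element of the `i`-th subspace of `A'` and one of the `i`-th subspace of
`A''`. -/
def componentwiseProduct (A' A'' : Subalgebra 𝕜 (Polynomial F)) :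
    Subalgebra 𝕜 (Polynomial F) where
  carrier := {f | ∀ i, f.coeff i ∈
    subspace (Subalgebra.toSubmodule A') i * subspace (Subalgebra.toSubmodule A'') i}
  mul_mem' {f g} hf hg i := by
    have key : ∀ (A : Subalgebra 𝕜 (Polynomial F)) (a b : ℕ),
        subspace (Subalgebra.toSubmodule A) a * subspace (Subalgebra.toSubmodule A) b ≤
          subspace (Subalgebra.toSubmodule A) (a + b) := by
      intro A a b
      refine Submodule.mul_le.mpr fun x hx y hy => ?_
      have := A.mul_mem hx hy
      simpa [subspace, homogeneous, Polynomial.monomial_mul_monomial] using this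
    rw [Polynomial.coeff_mul]
    refine Submodule.sum_mem _ fun x hx => ?_
    rw [← Finset.HasAntidiagonal.mem_antidiagonal.mp hx]
    have h := Submodule.mul_mem_mul (hf x.1) (hg x.2)
    rw [mul_mul_mul_comm] at h
    exact mul_le_mul' (key A' _ _) (key A'' _ _) h
  add_mem' {f g} hf hg i := by
    rw [Polynomial.coeff_add]
    exact Submodule.add_mem _ (hf i) (hg i)
  algebraMap_mem' r i := by
    rw [Polynomial.algebraMap_apply, Polynomial.coeff_C]
    split_ifs with h
    · subst h
      rw [← mul_one (algebraMap 𝕜 F r)]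
      refine Submodule.mul_mem_mul ?_ ?_
      · exact A'.algebraMap_mem r
      · exact A''.one_mem
    · exact Submodule.zero_mem _

/-- `a` is the `q`-th growth coefficient of `φ`, i.e. `φ(i) / i ^ q → a` as `i → ∞`. -/
def IsGrowthCoefficient (q : ℕ) (φ : ℕ → ℕ∞) (a : NNReal) : Prop :=
  Filter.Tendsto (fun i : ℕ => ((φ i : ℕ∞) : ENNReal) / (i : ENNReal) ^ q) Filter.atTop
    (nhds (a : ENNReal))

end GradedPoly

/-! ### Brunn–Minkowski for finite sets of lattice points -/

section

open scoped Pointwise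
open Finset MeasureTheory

/-! The algebra is turned into lattice points by a valuation, and the inequality becomes a discrete
Brunn–Minkowski inequality; no convex body or volume is needed.

Algebras of almost integral type have components inside the powers `N ^ k` of one finite dimensional
space, so everything lives in a finite extension `E` of a rational function field `K` in `n`
variables. Extending the lexicographic order of Laurent exponents from `K` to `E` gives a valuation
with value group free of rank `n`, whose graded pieces meet every subspace in a leaf of dimension at
most `[E : K]` (`exists_valuation_finrank_leaf_le`). The dimension of a subspace is the sum of its
leaf dimensions (`IsTrivialOver.sum_leafDim`). As the ground field is arbitrary, leaves need not be
lines, so values carry multiplicities. Multiplication by an element of value `α` embeds the leaf at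
`γ` into the leaf at `α + γ` (`IsTrivialOver.leafDim_le_leafDim_add`). Hence the multiplicities can
only grow under translation by the semigroup of values, and almost all of them equal their maximum
`D`: the growth coefficient is `D` times that of the number of values
(`WeightedSemigroup.tendsto_total`).

To count values, let `G` be the group of differences of values of equal degree. If `G` has full
rank, a translate of its unit cube lies in some level, so `add_pow_le_card_add_add_unitCube` applies
inside the semigroup at the cost of a bounded shift of degree. It makes the `n`-th root of the count
superadditive up to that shift, so a Fekete argument yields the limit; applied to levels of two
semigroups whose sums lie in a third, it yields the inequality (`LevelSemigroup.rpow_add_rpow_le`).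
If `G` has smaller rank, the growth of order `n` vanishes, by the bound of `exists_finrank_pow_le`.
Finally `D₁, D₂ ≤ D₃`, so restoring the multiplicities preserves the inequality. -/

/-- The vertices of the unit cube in `ℤⁿ`. -/
def unitCube (n : ℕ) : Finset (Fin n → ℤ) := Fintype.piFinset fun _ => {0, 1}

/-- Cauchy–Davenport in `ℤ` loses one point for `X + Y`; the summand `{0, 1}` wins it back. This is
why the unit cube appears in all dimensions. -/
lemma card_add_card_le_card_add_pair {X Y : Finset ℤ} (hX : X.Nonempty) (hY : Y.Nonempty) :
    #X + #Y ≤ #(X + Y + {0, 1}) := by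
  have h₁ := cauchy_davenport_of_isAddTorsionFree hX hY
  have h₂ := cauchy_davenport_of_isAddTorsionFree (hX.add hY) (insert_nonempty (0 : ℤ) {1})
  have h₃ : #({0, 1} : Finset ℤ) = 2 := rfl
  have := hX.card_pos
  omega

/-- Layer-cake formula: it trades sums of functions for cardinalities of superlevel sets. -/
lemma integral_card_filter_le {ι : Type*} (I : Finset ι) (φ : ι → ℝ) (h₀ : ∀ i ∈ I, 0 ≤ φ i)
    (h₁ : ∀ i ∈ I, φ i ≤ 1) :
    IntegrableOn (fun t : ℝ => ∑ i ∈ I, (Set.Iic (φ i)).indicator (fun _ => (1 : ℝ)) t)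
      (Set.Ioc 0 1) ∧
    ∫ t in Set.Ioc (0 : ℝ) 1, ∑ i ∈ I, (Set.Iic (φ i)).indicator (fun _ => (1 : ℝ)) t =
      ∑ i ∈ I, φ i := by
  have hint : ∀ i ∈ I, Integrable ((Set.Iic (φ i)).indicator (fun _ => (1 : ℝ)))
      (volume.restrict (Set.Ioc (0 : ℝ) 1)) := fun i _ =>
    (integrable_const 1).indicator measurableSet_Iic
  refine ⟨integrable_finsetSum _ hint, ?_⟩
  rw [integral_finsetSum _ hint]
  refine sum_congr rfl fun i hi => ?_
  rw [integral_indicator measurableSet_Iic, Measure.restrict_restrict measurableSet_Iic]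
  have : Set.Iic (φ i) ∩ Set.Ioc 0 1 = Set.Ioc 0 (φ i) := by
    ext t
    simp only [Set.mem_inter_iff, Set.mem_Iic, Set.mem_Ioc]
    have := h₁ i hi
    constructor
    · rintro ⟨a, b, c⟩; exact ⟨b, a⟩
    · rintro ⟨a, b⟩; exact ⟨b, a, b.trans this⟩
  rw [this]
  simp [h₀ i hi]

lemma sum_indicator_Iic_eq_card {ι : Type*} (I : Finset ι) (φ : ι → ℝ) (t : ℝ) :
    ∑ i ∈ I, (Set.Iic (φ i)).indicator (fun _ => (1 : ℝ)) t = #{i ∈ I | t ≤ φ i} := by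
  simp [Set.indicator_apply]

/-- A one-dimensional discrete inequality of Prékopa–Leindler type. -/
lemma sum_add_sum_le_of_superlevel {I J K : Finset ℤ} {φ ψ χ : ℤ → ℝ}
    (hφ₀ : ∀ i ∈ I, 0 ≤ φ i) (hφ₁ : ∀ i ∈ I, φ i ≤ 1) (hφ : ∃ i ∈ I, φ i = 1)
    (hψ₀ : ∀ i ∈ J, 0 ≤ ψ i) (hψ₁ : ∀ i ∈ J, ψ i ≤ 1) (hψ : ∃ i ∈ J, ψ i = 1)
    (hχ₀ : ∀ i ∈ K, 0 ≤ χ i)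
    (h : ∀ t, 0 < t → t ≤ 1 → ∀ i ∈ I, t ≤ φ i → ∀ j ∈ J, t ≤ ψ j → ∀ e ∈ ({0, 1} : Finset ℤ),
      i + j + e ∈ K ∧ t ≤ χ (i + j + e)) :
    ∑ i ∈ I, φ i + ∑ j ∈ J, ψ j ≤ ∑ m ∈ K, χ m := by
  -- Unlike `φ` and `ψ`, `χ` may exceed 1; truncated, it is covered by the layer-cake formula on
  -- `(0, 1]`.
  have hmin : ∑ m ∈ K, min (χ m) 1 ≤ ∑ m ∈ K, χ m := sum_le_sum fun _ _ => min_le_left _ _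
  refine le_trans ?_ hmin
  obtain ⟨iφ, eφ⟩ := integral_card_filter_le I φ hφ₀ hφ₁
  obtain ⟨iψ, eψ⟩ := integral_card_filter_le J ψ hψ₀ hψ₁
  obtain ⟨iχ, eχ⟩ := integral_card_filter_le K (fun m => min (χ m) 1)
    (fun i hi => le_min (hχ₀ i hi) zero_le_one) (fun _ _ => min_le_right _ _)
  rw [← eφ, ← eψ, ← eχ, ← integral_add iφ iψ]
  refine setIntegral_mono_on (iφ.add iψ) iχ measurableSet_Ioc fun t ht => ?_
  rw [sum_indicator_Iic_eq_card, sum_indicator_Iic_eq_card, sum_indicator_Iic_eq_card]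
  obtain ⟨i₀, hi₀, hi₁⟩ := hφ
  obtain ⟨j₀, hj₀, hj₁⟩ := hψ
  have hX : ({i ∈ I | t ≤ φ i}).Nonempty := ⟨i₀, by simp [hi₀, hi₁, ht.2]⟩
  have hY : ({i ∈ J | t ≤ ψ i}).Nonempty := ⟨j₀, by simp [hj₀, hj₁, ht.2]⟩
  have hsub : {i ∈ I | t ≤ φ i} + {i ∈ J | t ≤ ψ i} + {0, 1} ⊆ {i ∈ K | t ≤ min (χ i) 1} := by
    intro m hm
    obtain ⟨s, hs, e, he, rfl⟩ := mem_add.1 hm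
    obtain ⟨i, hi, j, hj, rfl⟩ := mem_add.1 hs
    rw [mem_filter] at hi hj ⊢
    obtain ⟨h₁, h₂⟩ := h t ht.1 ht.2 i hi.1 hi.2 j hj.1 hj.2 e he
    exact ⟨h₁, le_min h₂ ht.2⟩
  exact_mod_cast (card_add_card_le_card_add_pair hX hY).trans (card_le_card hsub)

/-- Convexity of `s ↦ s ^ (n + 1)` at the points `x / p` and `y / q` with weights proportional to
`p` and `q`. It recombines the slices in the induction on dimension. -/
lemma add_pow_succ_le_of_pos {n : ℕ} {x y p q : ℝ} (hx : 0 ≤ x) (hy : 0 ≤ y) (hp : 0 < p)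
    (hq : 0 < q) :
    (x + y) ^ (n + 1) ≤ (p + q) ^ n * (x ^ (n + 1) / p ^ n + y ^ (n + 1) / q ^ n) := by
  have h := (convexOn_pow (𝕜 := ℝ) (n + 1)).2 (div_nonneg hx hp.le) (div_nonneg hy hq.le)
    (div_nonneg hp.le (add_pos hp hq).le) (div_nonneg hq.le (add_pos hp hq).le)
    (by field_simp)
  simp only [smul_eq_mul] at h
  have e₁ : p / (p + q) * (x / p) + q / (p + q) * (y / q) = (x + y) / (p + q) := by field_simp
  rw [e₁, div_pow, div_pow, div_pow, div_le_iff₀ (by positivity)] at h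
  refine h.trans_eq ?_
  field_simp
  ring

/-- The section of a finite subset of `ℤⁿ⁺¹` over the first coordinate `i`. -/
def headSection {n : ℕ} (A : Finset (Fin (n + 1) → ℤ)) (i : ℤ) : Finset (Fin n → ℤ) :=
  ({a ∈ A | a 0 = i}).image Fin.tail

lemma mem_headSection {n : ℕ} {A : Finset (Fin (n + 1) → ℤ)} {i : ℤ} {a : Fin n → ℤ} :
    a ∈ headSection A i ↔ (Fin.cons i a : Fin (n + 1) → ℤ) ∈ A := by
  simp only [headSection, mem_image, mem_filter]
  constructor
  · rintro ⟨b, ⟨hb, rfl⟩, rfl⟩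
    rwa [Fin.cons_self_tail]
  · intro h
    exact ⟨_, ⟨h, by simp⟩, by simp⟩

lemma card_headSection {n : ℕ} (A : Finset (Fin (n + 1) → ℤ)) (i : ℤ) :
    #(headSection A i) = #{a ∈ A | a 0 = i} := by
  refine card_image_of_injOn fun a ha b hb hab => ?_
  simp only [coe_filter, Set.mem_ofPred_eq] at ha hb
  rw [← Fin.cons_self_tail a, ← Fin.cons_self_tail b, ha.2, hb.2, hab]

lemma sum_card_headSection {n : ℕ} (A : Finset (Fin (n + 1) → ℤ)) :
    ∑ i ∈ A.image (· 0), #(headSection A i) = #A := by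
  simp_rw [card_headSection]
  exact (card_eq_sum_card_image _ _).symm

lemma headSection_nonempty {n : ℕ} {A : Finset (Fin (n + 1) → ℤ)} {i : ℤ}
    (hi : i ∈ A.image (· 0)) : (headSection A i).Nonempty := by
  obtain ⟨a, ha, rfl⟩ := mem_image.1 hi
  exact ⟨Fin.tail a, mem_headSection.2 (by rwa [Fin.cons_self_tail])⟩

lemma headSection_add_subset {n : ℕ} (A B : Finset (Fin (n + 1) → ℤ)) {i j e : ℤ}
    (he : e ∈ ({0, 1} : Finset ℤ)) :
    headSection A i + headSection B j + unitCube n ⊆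
      headSection (A + B + unitCube (n + 1)) (i + j + e) := by
  intro m hm
  obtain ⟨s, hs, c, hc, rfl⟩ := mem_add.1 hm
  obtain ⟨a, ha, b, hb, rfl⟩ := mem_add.1 hs
  rw [mem_headSection] at ha hb ⊢
  have : (Fin.cons (i + j + e) (a + b + c) : Fin (n + 1) → ℤ) =
      Fin.cons i a + Fin.cons j b + Fin.cons e c := by
    ext l
    refine Fin.cases ?_ (fun l => ?_) l <;> simp
  rw [this]
  refine add_mem_add (add_mem_add ha hb) ?_
  simp only [unitCube, Fintype.mem_piFinset] at hc ⊢
  exact fun l => Fin.cases (by simpa using he) (fun l => by simpa using hc l) l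

lemma exists_pow_eq_card_of_headSection {n : ℕ} {A : Finset (Fin (n + 1) → ℤ)} {i : ℤ}
    (hi : i ∈ A.image (· 0)) : ∃ p : ℝ, 0 < p ∧ p ^ n = #(headSection A i) := by
  have hpos := (headSection_nonempty hi).card_pos
  rcases Nat.eq_zero_or_pos n with rfl | hn
  · refine ⟨1, one_pos, ?_⟩
    have : #(headSection A i) ≤ 1 := card_le_one.2 fun a _ b _ => Subsingleton.elim a b
    have : #(headSection A i) = 1 := by omega
    simp [this]
  · exact ⟨(#(headSection A i) : ℝ) ^ (1 / (n : ℝ)), by positivity, by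
      rw [one_div, Real.rpow_inv_natCast_pow (by positivity) hn.ne']⟩

/-- **Discrete Brunn–Minkowski inequality**: `|A + B + {0,1}ⁿ|^(1/n) ≥ |A|^(1/n) + |B|^(1/n)` for
non-empty finite subsets of `ℤⁿ`. -/
theorem add_pow_le_card_add_add_unitCube : ∀ (n : ℕ) (A B : Finset (Fin n → ℤ)), A.Nonempty →
    B.Nonempty → ∀ x y : ℝ, 0 ≤ x → 0 ≤ y → x ^ n ≤ #A → y ^ n ≤ #B →
    (x + y) ^ n ≤ #(A + B + unitCube n)
  | 0, A, B, hA, hB, x, y, _, _, _, _ => by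
    have : (A + B + unitCube 0).Nonempty := (hA.add hB).add ⟨0, Fintype.mem_piFinset.2 nofun⟩
    simpa using this
  | n + 1, A, B, hA, hB, x, y, hx, hy, hxA, hyB => by
    obtain ⟨i₀, hi₀, hi₁⟩ := exists_max_image (A.image (· 0)) (fun i => #(headSection A i))
      (hA.image _)
    obtain ⟨j₀, hj₀, hj₁⟩ := exists_max_image (B.image (· 0)) (fun i => #(headSection B i))
      (hB.image _)
    obtain ⟨p, hp, hpA⟩ := exists_pow_eq_card_of_headSection hi₀
    obtain ⟨q, hq, hqB⟩ := exists_pow_eq_card_of_headSection hj₀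
    set C := A + B + unitCube (n + 1) with hC
    -- Section sizes are scaled by their maxima `p ^ n` and `q ^ n`, so no superlevel set with `t ≤
    -- 1` is empty; the matching scale for the sumset is `(p + q) ^ n`.
    have key := sum_add_sum_le_of_superlevel (I := A.image (· 0)) (J := B.image (· 0))
      (K := C.image (· 0)) (φ := fun i => #(headSection A i) / p ^ n)
      (ψ := fun i => #(headSection B i) / q ^ n) (χ := fun i => #(headSection C i) / (p + q) ^ n)
      (fun i _ => by positivity)
      (fun i hi => by
        rw [div_le_one (by positivity), hpA]
        exact_mod_cast hi₁ i hi)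
      ⟨i₀, hi₀, by rw [← hpA]; field_simp⟩
      (fun i _ => by positivity)
      (fun i hi => by
        rw [div_le_one (by positivity), hqB]
        exact_mod_cast hj₁ i hi)
      ⟨j₀, hj₀, by rw [← hqB]; field_simp⟩
      (fun i _ => by positivity)
      (fun t ht ht1 i hi hti j hj htj e he => by
        have hsub := headSection_add_subset A B (i := i) (j := j) he
        have hne₁ := headSection_nonempty hi
        have hne₂ := headSection_nonempty hj
        constructor
        · have hne : (headSection A i + headSection B j + unitCube n).Nonempty :=
            (hne₁.add hne₂).add ⟨0, by simp [unitCube]⟩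
          obtain ⟨m, hm⟩ := hne.mono hsub
          exact mem_image.2 ⟨_, mem_headSection.1 hm, by simp⟩
        · rw [le_div_iff₀ (by positivity)] at hti htj ⊢
          -- `τ` is the `n`-th root of `t`, so that the sections contain at least `(τ p) ^ n` and
          -- `(τ q) ^ n` points; in dimension 0 there is no root to take and `τ = 1` serves.
          obtain ⟨τ, hτ, hτ₁, hτ₂, hτ₃⟩ : ∃ τ : ℝ, 0 ≤ τ ∧ t ≤ τ ^ n ∧
              τ ^ n * p ^ n ≤ #(headSection A i) ∧ τ ^ n * q ^ n ≤ #(headSection B j) := by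
            rcases Nat.eq_zero_or_pos n with rfl | hn
            · exact ⟨1, zero_le_one, by simpa using ht1, by simpa using hne₁,
                by simpa using hne₂⟩
            · have : (t ^ (1 / (n : ℝ))) ^ n = t := by
                rw [one_div, Real.rpow_inv_natCast_pow ht.le hn.ne']
              exact ⟨t ^ (1 / (n : ℝ)), by positivity, this.ge, by rwa [this], by rwa [this]⟩
          have ih := add_pow_le_card_add_add_unitCube n _ _ hne₁ hne₂ (τ * p) (τ * q)
            (by positivity) (by positivity) (by rwa [mul_pow]) (by rwa [mul_pow])
          rw [← mul_add, mul_pow] at ih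
          calc t * (p + q) ^ n ≤ τ ^ n * (p + q) ^ n := by gcongr
            _ ≤ _ := ih
            _ ≤ _ := by exact_mod_cast card_le_card hsub)
    rw [← sum_div, ← sum_div, ← sum_div, ← Nat.cast_sum, ← Nat.cast_sum, ← Nat.cast_sum,
      sum_card_headSection, sum_card_headSection, sum_card_headSection,
      le_div_iff₀ (by positivity)] at key
    calc (x + y) ^ (n + 1) ≤ (p + q) ^ n * (x ^ (n + 1) / p ^ n + y ^ (n + 1) / q ^ n) :=
          add_pow_succ_le_of_pos hx hy hp hq
      _ ≤ (p + q) ^ n * (#A / p ^ n + #B / q ^ n) := by gcongr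
      _ ≤ #C := by linarith

end

/-! ### Growth of semigroups of lattice points -/

section

open scoped Pointwise
open Finset Filter Topology

lemma tendsto_div_pow_add_iff {f : ℕ → ℝ} {σ : ℝ} (n c : ℕ) :
    Tendsto (fun k : ℕ => f (k + c) / (k : ℝ) ^ n) atTop (𝓝 σ) ↔
      Tendsto (fun k : ℕ => f k / (k : ℝ) ^ n) atTop (𝓝 σ) := by
  rw [← tendsto_add_atTop_iff_nat (f := fun k : ℕ => f k / (k : ℝ) ^ n) c]
  have h1 : Tendsto (fun k : ℕ => (k : ℝ) / ((k + c : ℕ) : ℝ)) atTop (𝓝 1) := by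
    simpa using tendsto_natCast_div_add_atTop (c : ℝ)
  have h2 : Tendsto (fun k : ℕ => ((k : ℝ) / ((k + c : ℕ) : ℝ)) ^ n) atTop (𝓝 1) := by
    simpa using h1.pow n
  have h3 : Tendsto (fun k : ℕ => (((k : ℝ) / ((k + c : ℕ) : ℝ)) ^ n)⁻¹) atTop (𝓝 1) := by
    simpa using h2.inv₀ one_ne_zero
  constructor
  · intro h
    have := h.mul h2
    rw [mul_one] at this
    refine this.congr' ?_
    filter_upwards [eventually_ge_atTop 1] with k hk
    have : (k : ℝ) ≠ 0 := by positivity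
    rw [div_pow]
    field_simp
  · intro h
    have := h.mul h3
    rw [mul_one] at this
    refine this.congr' ?_
    filter_upwards [eventually_ge_atTop 1] with k hk
    have : (k : ℝ) ≠ 0 := by positivity
    have : ((k + c : ℕ) : ℝ) ≠ 0 := by positivity
    rw [div_pow]
    field_simp

/-- A version of Fekete's lemma for sequences that are superadditive up to a shift. -/
lemma exists_tendsto_div_of_superadditive {r : ℕ → ℝ} {j₀ k₀ : ℕ} {C : ℝ} (h₀ : ∀ k, 0 ≤ r k)
    (hsup : ∀ k l, r k + r l ≤ r (k + l + k₀)) (hmono : ∀ k, ∀ j ≥ j₀, r k ≤ r (k + j))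
    (hC : ∀ k ≥ 1, r k ≤ C * k) :
    ∃ L : ℝ, Tendsto (fun k : ℕ => r k / k) atTop (𝓝 L) := by
  -- `r` is monotone only along steps of length at least `j₀`; its running maximum is monotone, and
  -- `M k ≤ r (k + j₀) ≤ M (k + j₀)` carries the limit back to `r`.
  set M : ℕ → ℝ := fun k => (range (k + 1)).sup' nonempty_range_add_one r with hM
  have hle : ∀ {j k}, j ≤ k → r j ≤ M k := fun {j k} hjk =>
    le_sup' r (mem_range.2 (by omega))
  have hMmono : Monotone M := fun a b hab =>
    sup'_le _ _ fun j hj => hle (by have := mem_range.1 hj; omega)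
  have hM₀ : ∀ k, 0 ≤ M k := fun k => (h₀ k).trans (hle le_rfl)
  have hex : ∀ k, ∃ j ≤ k, M k = r j := fun k => by
    obtain ⟨j, hj, h⟩ := exists_mem_eq_sup' (nonempty_range_add_one (n := k)) r
    exact ⟨j, by have := mem_range.1 hj; omega, h⟩
  have hMsup : ∀ k l, M k + M l ≤ M (k + l + k₀) := fun k l => by
    obtain ⟨i, hi, hi'⟩ := hex k
    obtain ⟨j, hj, hj'⟩ := hex l
    rw [hi', hj']
    exact (hsup i j).trans (hle (by omega))
  have hMr : ∀ k, M k ≤ r (k + j₀) := fun k => by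
    obtain ⟨j, hj, h⟩ := hex k
    rw [h, show k + j₀ = j + (k + j₀ - j) by omega]
    exact hmono j _ (by omega)
  have hC0 : 0 ≤ C := by simpa using (h₀ 1).trans (hC 1 le_rfl)
  have hMC : ∀ k, M k ≤ C * k + r 0 := fun k => by
    obtain ⟨j, hj, h⟩ := hex k
    rw [h]
    rcases Nat.eq_zero_or_pos j with rfl | hj0
    · have : 0 ≤ C * k := by positivity
      linarith
    · have h1 := hC j hj0
      have h2 : C * j ≤ C * k := by gcongr
      linarith [h₀ 0]
  -- Delaying `M` by `k₀` absorbs the shift: `w` is genuinely superadditive.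
  set w : ℕ → ℝ := fun k => if k < k₀ then 0 else M (k - k₀) with hw
  have hw₀ : ∀ k, 0 ≤ w k := fun k => by
    simp only [hw]; split_ifs
    exacts [le_rfl, hM₀ _]
  have hsub : Subadditive fun k => -w k := fun k l => by
    suffices w k + w l ≤ w (k + l) by linarith
    by_cases hk : k < k₀
    · by_cases hl : l < k₀
      · have := hw₀ (k + l)
        simpa [hw, hk, hl] using this
      · have h3 : ¬ k + l < k₀ := by omega
        simp only [hw, hk, hl, h3, if_true, if_false, zero_add]
        exact hMmono (by omega)
    · by_cases hl : l < k₀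
      · have h3 : ¬ k + l < k₀ := by omega
        simp only [hw, hk, hl, h3, if_true, if_false, add_zero]
        exact hMmono (by omega)
      · have h3 : ¬ k + l < k₀ := by omega
        simp only [hw, hk, hl, h3, if_false]
        refine (hMsup _ _).trans (hMmono (by omega))
  have hbdd : BddBelow (Set.range fun k : ℕ => -w k / k) := by
    refine ⟨-(C + r 0), ?_⟩
    rintro _ ⟨k, rfl⟩
    rcases Nat.eq_zero_or_pos k with rfl | hk
    · have := h₀ 0
      simp only [CharP.cast_eq_zero, div_zero]
      linarith
    · have hk' : (1 : ℝ) ≤ k := by exact_mod_cast hk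
      have : w k ≤ C * k + r 0 := by
        simp only [hw]; split_ifs
        · have := h₀ 0; positivity
        · refine (hMmono (Nat.sub_le _ _)).trans (hMC k)
      simp only [neg_div, neg_le_neg_iff]
      rw [div_le_iff₀ (by linarith)]
      nlinarith [h₀ 0]
  have hlim := hsub.tendsto_lim hbdd
  have hlimw : Tendsto (fun k : ℕ => w k / (k : ℝ) ^ 1) atTop (𝓝 (-hsub.lim)) := by
    simpa [neg_div] using hlim.neg
  have hlimM : Tendsto (fun k : ℕ => M k / (k : ℝ) ^ 1) atTop (𝓝 (-hsub.lim)) := by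
    refine ((tendsto_div_pow_add_iff 1 k₀).2 hlimw).congr fun k => ?_
    simp [hw]
  have hlimM' := (tendsto_div_pow_add_iff 1 j₀).2 hlimM
  have hlimr : Tendsto (fun k : ℕ => r (k + j₀) / (k : ℝ) ^ 1) atTop (𝓝 (-hsub.lim)) := by
    refine tendsto_of_tendsto_of_tendsto_of_le_of_le hlimM hlimM' (fun k => ?_) (fun k => ?_)
    · exact div_le_div_of_nonneg_right (hMr k) (by positivity)
    · exact div_le_div_of_nonneg_right (hle le_rfl) (by positivity)
  exact ⟨-hsub.lim, by simpa using (tendsto_div_pow_add_iff 1 j₀).1 hlimr⟩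

/-- A subsemigroup of `ℕ × Γ` with finite levels that are eventually non-empty. -/
structure LevelSemigroup (Γ : Type*) [AddCommGroup Γ] where
  /-- The elements of a given degree. -/
  level : ℕ → Finset Γ
  add_mem : ∀ {i j a b}, a ∈ level i → b ∈ level j → a + b ∈ level (i + j)
  /-- A degree from which on all levels are non-empty. -/
  start : ℕ
  nonempty : ∀ j ≥ start, (level j).Nonempty

namespace LevelSemigroup

variable {Γ : Type*} [AddCommGroup Γ]

/-- The group of differences of elements of equal degree. -/
def differences (S : LevelSemigroup Γ) : AddSubgroup Γ where
  carrier := {g | ∃ k, ∃ a ∈ S.level k, ∃ b ∈ S.level k, a - b = g}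
  zero_mem' := by
    obtain ⟨a, ha⟩ := S.nonempty S.start le_rfl
    exact ⟨_, a, ha, a, ha, sub_self a⟩
  add_mem' := by
    rintro _ _ ⟨k, a, ha, b, hb, rfl⟩ ⟨l, a', ha', b', hb', rfl⟩
    exact ⟨k + l, a + a', S.add_mem ha ha', b + b', S.add_mem hb hb', by abel⟩
  neg_mem' := by
    rintro _ ⟨k, a, ha, b, hb, rfl⟩
    exact ⟨k, b, hb, a, ha, by abel⟩

lemma sub_mem_differences (S : LevelSemigroup Γ) {k : ℕ} {a b : Γ} (ha : a ∈ S.level k)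
    (hb : b ∈ S.level k) : a - b ∈ S.differences := ⟨k, a, ha, b, hb, rfl⟩

/-- By induction on `T`: if `c` translates `T` and `g = a - b`, then `c + b` translates `T ∪ {g}`,
since `g + (c + b) = c + a`. -/
lemma exists_translate_mem (S : LevelSemigroup Γ) (T : Finset Γ)
    (hT : ∀ g ∈ T, g ∈ S.differences) :
    ∃ k, ∃ c ∈ S.level k, ∀ g ∈ T, g + c ∈ S.level k := by
  classical
  induction T using Finset.induction_on with
  | empty =>
    obtain ⟨a, ha⟩ := S.nonempty S.start le_rfl
    exact ⟨_, a, ha, by simp⟩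
  | insert g T _ ih =>
    obtain ⟨k, c, hc, h⟩ := ih fun x hx => hT x (mem_insert_of_mem hx)
    obtain ⟨l, a, ha, b, hb, rfl⟩ := hT g (mem_insert_self _ _)
    refine ⟨k + l, c + b, S.add_mem hc hb, fun x hx => ?_⟩
    rcases mem_insert.1 hx with rfl | hx
    · convert S.add_mem hc ha using 1
      abel
    · rw [← add_assoc]
      exact S.add_mem (h x hx) hb

lemma card_level_le_add (S : LevelSemigroup Γ) (k : ℕ) {j : ℕ} (hj : S.start ≤ j) :
    #(S.level k) ≤ #(S.level (k + j)) := by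
  obtain ⟨b, hb⟩ := S.nonempty j hj
  exact card_le_card_of_injOn (· + b) (fun a ha => S.add_mem ha hb) (add_left_injective b).injOn

/-- For every `e`, the `k`-th level stays within a set of size `O(kⁿ)` when up to `k` copies of `e`
are added to it. -/
def HasGrowth (S : LevelSemigroup Γ) (n : ℕ) : Prop :=
  ∀ e : Γ, ∃ (T : ℕ → Finset Γ) (C : ℝ),
    (∀ k, ∀ a ∈ S.level k, ∀ j ≤ k, a + j • e ∈ T k) ∧ ∀ k ≥ 1, (#(T k) : ℝ) ≤ C * (k : ℝ) ^ n

lemma HasGrowth.card_le {S : LevelSemigroup Γ} {n : ℕ} (h : S.HasGrowth n) :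
    ∃ C : ℝ, ∀ k ≥ 1, (#(S.level k) : ℝ) ≤ C * (k : ℝ) ^ n := by
  obtain ⟨T, C, hT, hC⟩ := h 0
  refine ⟨C, fun k hk => le_trans ?_ (hC k hk)⟩
  exact_mod_cast card_le_card fun a ha => by simpa using hT k a ha 0 (Nat.zero_le _)

/-- The translates of the `k`-th level by `0, e, …, k • e` are disjoint and lie in a set of size
`O(kⁿ)`, so the level itself has size `O(kⁿ⁻¹)`. -/
lemma tendsto_zero_of_forall_smul_notMem {S : LevelSemigroup Γ} {n : ℕ} (h : S.HasGrowth n)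
    {e : Γ} (he : ∀ m : ℤ, m ≠ 0 → m • e ∉ S.differences) :
    Tendsto (fun k : ℕ => (#(S.level k) : ℝ) / (k : ℝ) ^ n) atTop (𝓝 0) := by
  obtain ⟨T, C, hT, hC⟩ := h e
  have hcard : ∀ k, (k + 1) * #(S.level k) ≤ #(T k) := fun k => by
    rw [← card_range (k + 1), ← card_product]
    refine card_le_card_of_injOn (fun x => x.2 + x.1 • e) (fun x hx => ?_) ?_
    · have hx := mem_product.1 hx
      exact hT k _ hx.2 _ (by have := mem_range.1 hx.1; omega)
    · rintro ⟨i, a⟩ hx ⟨j, b⟩ hy hxy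
      have hx := (mem_product.1 hx).2
      have hy := (mem_product.1 hy).2
      simp only at hx hy hxy
      have hmem : ((j : ℤ) - i) • e ∈ S.differences := by
        have : ((j : ℤ) - i) • e = a - b := by
          rw [sub_smul, natCast_zsmul, natCast_zsmul, sub_eq_sub_iff_add_eq_add, add_comm, ← hxy]
        rw [this]
        exact S.sub_mem_differences hx hy
      have hij : (j : ℤ) - i = 0 := by
        by_contra hne
        exact he _ hne hmem
      obtain rfl : i = j := by omega
      simpa using hxy
  refine squeeze_zero' (Eventually.of_forall fun k => by positivity) ?_
    ((tendsto_const_div_atTop_nhds_zero_nat C).comp (tendsto_add_atTop_nat 1))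
  filter_upwards [eventually_ge_atTop 1] with k hk
  have hk' : (0 : ℝ) < (k : ℝ) ^ n := by positivity
  rw [div_le_iff₀ hk', Function.comp_apply, div_mul_eq_mul_div, le_div_iff₀ (by positivity)]
  calc (#(S.level k) : ℝ) * ((k + 1 : ℕ) : ℝ) = (((k + 1) * #(S.level k) : ℕ) : ℝ) := by
        push_cast; ring
    _ ≤ #(T k) := by exact_mod_cast hcard k
    _ ≤ _ := hC k hk

end LevelSemigroup

lemma exists_image_eq_of_sub_mem {Γ ι : Type*} [AddCommGroup Γ] [DecidableEq Γ] [AddCommGroup ι]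
    {G : AddSubgroup Γ} (φ : ι ≃+ G) {A : Finset Γ} {a₀ : Γ} (hA : ∀ a ∈ A, a - a₀ ∈ G) :
    ∃ A' : Finset ι, A'.image (fun z => (φ z : Γ) + a₀) = A := by
  classical
  have hinj : Function.Injective fun z => (φ z : Γ) + a₀ := fun z w h =>
    φ.injective (Subtype.ext (add_right_cancel h))
  refine ⟨A.preimage _ hinj.injOn, ?_⟩
  rw [image_preimage, filter_true_of_mem]
  exact fun a ha => ⟨φ.symm ⟨_, hA a ha⟩, by simp⟩

/-- `A` and `B` each lie in a single coset of `G`, and choosing base points carries them into `ℤⁿ`.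
-/
theorem add_pow_le_card_add_add_image_unitCube {Γ : Type*} [AddCommGroup Γ] [DecidableEq Γ] {n : ℕ}
    {G : AddSubgroup Γ} (φ : (Fin n → ℤ) ≃+ G) {A B : Finset Γ} (hA : A.Nonempty)
    (hB : B.Nonempty) (hAG : ∀ a ∈ A, ∀ a' ∈ A, a - a' ∈ G) (hBG : ∀ b ∈ B, ∀ b' ∈ B, b - b' ∈ G)
    {x y : ℝ} (hx : 0 ≤ x) (hy : 0 ≤ y) (hxA : x ^ n ≤ #A) (hyB : y ^ n ≤ #B) :
    (x + y) ^ n ≤ #(A + B + (unitCube n).image fun z => (φ z : Γ)) := by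
  obtain ⟨a₀, ha₀⟩ := hA
  obtain ⟨b₀, hb₀⟩ := hB
  have hinj : ∀ c, Function.Injective fun z => (φ z : Γ) + c := fun c z w h =>
    φ.injective (Subtype.ext (add_right_cancel h))
  obtain ⟨A', rfl⟩ := exists_image_eq_of_sub_mem φ fun a ha => hAG a ha a₀ ha₀
  obtain ⟨B', rfl⟩ := exists_image_eq_of_sub_mem φ fun b hb => hBG b hb b₀ hb₀
  rw [card_image_of_injective _ (hinj _)] at hxA hyB
  refine (add_pow_le_card_add_add_unitCube n A' B' ?_ ?_ x y hx hy hxA hyB).trans ?_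
  · exact (image_nonempty.1 ⟨a₀, ha₀⟩)
  · exact (image_nonempty.1 ⟨b₀, hb₀⟩)
  · rw [← card_image_of_injective _ (hinj (a₀ + b₀))]
    refine mod_cast card_le_card fun g hg => ?_
    obtain ⟨z, hz, rfl⟩ := mem_image.1 hg
    obtain ⟨s, hs, c, hc, rfl⟩ := mem_add.1 hz
    obtain ⟨a, ha, b, hb, rfl⟩ := mem_add.1 hs
    have : (φ (a + b + c) : Γ) + (a₀ + b₀) = (φ a + a₀) + (φ b + b₀) + φ c := by
      simp only [map_add, AddSubgroup.coe_add]
      abel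
    rw [this]
    exact add_mem_add (add_mem_add (mem_image_of_mem _ ha) (mem_image_of_mem _ hb))
      (mem_image_of_mem _ hc)

namespace LevelSemigroup

variable {Γ : Type*} [AddCommGroup Γ]

/-- Some `c` of degree `k₀` translates the unit cube of the difference group into a level, so `A + B
+ cube + c` stays in the semigroup. `A` and `B` are not required to be levels of `S`: they will also
be levels of two other semigroups. -/
lemma exists_card_rpow_add_le (S : LevelSemigroup Γ) {n : ℕ} (hn : n ≠ 0)
    (φ : (Fin n → ℤ) ≃+ S.differences) :
    ∃ k₀ : ℕ, ∀ (A B : Finset Γ) (k l : ℕ), A.Nonempty → B.Nonempty →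
      (∀ a ∈ A, ∀ a' ∈ A, a - a' ∈ S.differences) → (∀ b ∈ B, ∀ b' ∈ B, b - b' ∈ S.differences) →
      (∀ a ∈ A, ∀ b ∈ B, a + b ∈ S.level (k + l)) →
      (#A : ℝ) ^ (n : ℝ)⁻¹ + (#B : ℝ) ^ (n : ℝ)⁻¹ ≤ (#(S.level (k + l + k₀)) : ℝ) ^ (n : ℝ)⁻¹ := by
  classical
  obtain ⟨k₀, c, hc, hk⟩ := S.exists_translate_mem ((unitCube n).image fun z => (φ z : Γ))
    fun g hg => by
      obtain ⟨z, _, rfl⟩ := mem_image.1 hg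
      exact (φ z).2
  refine ⟨k₀, fun A B k l hA hB hAG hBG hAB => ?_⟩
  have h := add_pow_le_card_add_add_image_unitCube φ hA hB hAG hBG
    (x := (#A : ℝ) ^ (n : ℝ)⁻¹) (y := (#B : ℝ) ^ (n : ℝ)⁻¹) (by positivity) (by positivity)
    (Real.rpow_inv_natCast_pow (by positivity) hn).le
    (Real.rpow_inv_natCast_pow (by positivity) hn).le
  have hle : #(A + B + (unitCube n).image fun z => (φ z : Γ)) ≤ #(S.level (k + l + k₀)) := by
    refine card_le_card_of_injOn (· + c) (fun g hg => ?_) (add_left_injective c).injOn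
    obtain ⟨s, hs, z, hz, rfl⟩ := mem_add.1 hg
    obtain ⟨a, ha, b, hb, rfl⟩ := mem_add.1 hs
    simp only
    rw [add_assoc (a + b) z c]
    exact S.add_mem (hAB a ha b hb) (hk z hz)
  rw [← Real.pow_rpow_inv_natCast (x := (#A : ℝ) ^ (n : ℝ)⁻¹ + (#B : ℝ) ^ (n : ℝ)⁻¹)
    (by positivity) hn]
  exact Real.rpow_le_rpow (by positivity) (h.trans (mod_cast hle)) (by positivity)

/-- The dichotomy between the two regimes: full rank, where Brunn–Minkowski applies, and smaller
rank, where the growth coefficient is zero. -/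
lemma equiv_or_exists_smul_notMem [Module.Free ℤ Γ] [Module.Finite ℤ Γ] (G : AddSubgroup Γ) :
    Nonempty ((Fin (Module.finrank ℤ Γ) → ℤ) ≃+ G) ∨ ∃ e : Γ, ∀ m : ℤ, m ≠ 0 → m • e ∉ G := by
  rcases (Submodule.finrank_le (AddSubgroup.toIntSubmodule G)).eq_or_lt with h | h
  · exact .inl ⟨(Module.finBasisOfFinrankEq ℤ _ h).equivFun.symm.toAddEquiv⟩
  · refine .inr ?_
    have : Module.rank ℤ (AddSubgroup.toIntSubmodule G) < Module.rank ℤ Γ := by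
      rw [← Module.finrank_eq_rank, ← Module.finrank_eq_rank]
      exact_mod_cast h
    exact Submodule.exists_smul_notMem_of_rank_lt this

variable [Module.Free ℤ Γ] [Module.Finite ℤ Γ] {n : ℕ}

theorem HasGrowth.exists_tendsto {S : LevelSemigroup Γ} (hn : n ≠ 0)
    (hΓ : Module.finrank ℤ Γ = n) (h : S.HasGrowth n) :
    ∃ σ : ℝ, Tendsto (fun k : ℕ => (#(S.level k) : ℝ) / (k : ℝ) ^ n) atTop (𝓝 σ) := by
  rcases equiv_or_exists_smul_notMem S.differences with ⟨⟨φ⟩⟩ | ⟨e, he⟩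
  swap
  · exact ⟨0, tendsto_zero_of_forall_smul_notMem h he⟩
  rw [hΓ] at φ
  obtain ⟨k₀, hk₀⟩ := S.exists_card_rpow_add_le hn φ
  obtain ⟨C, hC⟩ := h.card_le
  have hninv : (0 : ℝ) ≤ (n : ℝ)⁻¹ := by positivity
  have hmono : ∀ k, ∀ j ≥ S.start, (#(S.level k) : ℝ) ^ (n : ℝ)⁻¹ ≤
      (#(S.level (k + j)) : ℝ) ^ (n : ℝ)⁻¹ := fun k j hj =>
    Real.rpow_le_rpow (by positivity) (mod_cast S.card_level_le_add k hj) hninv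
  have hC0 : 0 ≤ C := by
    have := hC 1 le_rfl
    simp only [Nat.cast_one, one_pow, mul_one] at this
    exact le_trans (by positivity) this
  -- The extra shift by `S.start` covers empty levels, for which only monotonicity is available.
  have hsup : ∀ k l, (#(S.level k) : ℝ) ^ (n : ℝ)⁻¹ + (#(S.level l) : ℝ) ^ (n : ℝ)⁻¹ ≤
      (#(S.level (k + l + (k₀ + S.start))) : ℝ) ^ (n : ℝ)⁻¹ := fun k l => by
    have hz : (0 : ℝ) ^ (n : ℝ)⁻¹ = 0 := Real.zero_rpow (by positivity)
    rcases (S.level k).eq_empty_or_nonempty with hk | hk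
    · rw [hk, card_empty, Nat.cast_zero, hz, zero_add,
        show k + l + (k₀ + S.start) = l + (k + k₀ + S.start) by ring]
      exact hmono _ _ (by omega)
    rcases (S.level l).eq_empty_or_nonempty with hl | hl
    · rw [hl, card_empty, Nat.cast_zero, hz, add_zero, add_assoc]
      exact hmono _ _ (by omega)
    rw [← add_assoc]
    exact (hk₀ _ _ k l hk hl (fun a ha b hb => S.sub_mem_differences ha hb)
      (fun a ha b hb => S.sub_mem_differences ha hb) fun a ha b hb => S.add_mem ha hb).trans
      (hmono _ _ le_rfl)
  have hbound : ∀ k ≥ 1, (#(S.level k) : ℝ) ^ (n : ℝ)⁻¹ ≤ C ^ (n : ℝ)⁻¹ * k := fun k hk =>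
    calc (#(S.level k) : ℝ) ^ (n : ℝ)⁻¹ ≤ (C * (k : ℝ) ^ n) ^ (n : ℝ)⁻¹ :=
          Real.rpow_le_rpow (by positivity) (hC k hk) hninv
      _ = _ := by
        rw [Real.mul_rpow hC0 (by positivity), Real.pow_rpow_inv_natCast (by positivity) hn]
  obtain ⟨L, hL⟩ := exists_tendsto_div_of_superadditive (fun k => by positivity) hsup hmono hbound
  refine ⟨L ^ n, (hL.pow n).congr fun k => ?_⟩
  rw [div_pow, Real.rpow_inv_natCast_pow (by positivity) hn]

theorem rpow_add_rpow_le {S₁ S₂ S₃ : LevelSemigroup Γ} (hn : n ≠ 0)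
    (hΓ : Module.finrank ℤ Γ = n) (h₃ : S₃.HasGrowth n)
    (hadd : ∀ k, ∀ a ∈ S₁.level k, ∀ b ∈ S₂.level k, a + b ∈ S₃.level k) {σ₁ σ₂ σ₃ : ℝ}
    (hσ₁ : Tendsto (fun k : ℕ => (#(S₁.level k) : ℝ) / (k : ℝ) ^ n) atTop (𝓝 σ₁))
    (hσ₂ : Tendsto (fun k : ℕ => (#(S₂.level k) : ℝ) / (k : ℝ) ^ n) atTop (𝓝 σ₂))
    (hσ₃ : Tendsto (fun k : ℕ => (#(S₃.level k) : ℝ) / (k : ℝ) ^ n) atTop (𝓝 σ₃)) :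
    σ₁ ^ (n : ℝ)⁻¹ + σ₂ ^ (n : ℝ)⁻¹ ≤ σ₃ ^ (n : ℝ)⁻¹ := by
  have hlarge : ∀ᶠ k in atTop, (S₁.level k).Nonempty ∧ (S₂.level k).Nonempty := by
    filter_upwards [eventually_ge_atTop (max S₁.start S₂.start)] with k hk
    exact ⟨S₁.nonempty k (le_of_max_le_left hk), S₂.nonempty k (le_of_max_le_right hk)⟩
  have hninv : (0 : ℝ) ≤ (n : ℝ)⁻¹ := by positivity
  rcases equiv_or_exists_smul_notMem S₃.differences with ⟨⟨φ⟩⟩ | ⟨e, he⟩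
  · rw [hΓ] at φ
    obtain ⟨k₀, hk₀⟩ := S₃.exists_card_rpow_add_le hn φ
    have hcont : ∀ {f : ℕ → ℝ} {σ : ℝ}, Tendsto f atTop (𝓝 σ) →
        Tendsto (fun k => f k ^ (n : ℝ)⁻¹) atTop (𝓝 (σ ^ (n : ℝ)⁻¹)) := fun h =>
      ((Real.continuous_rpow_const hninv).tendsto _).comp h
    have hσ₃' := (tendsto_div_pow_add_iff (f := fun k => (#(S₃.level k) : ℝ)) n k₀).2 hσ₃
    refine le_of_tendsto_of_tendsto ((hcont hσ₁).add (hcont hσ₂)) (hcont hσ₃') ?_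
    filter_upwards [hlarge] with k hk
    rw [Real.div_rpow (by positivity) (by positivity), Real.div_rpow (by positivity)
      (by positivity), Real.div_rpow (by positivity) (by positivity), ← add_div]
    refine div_le_div_of_nonneg_right ?_ (by positivity)
    -- Both sets have degree `k` and so do their sums in `S₃`, hence the total degree is split as `k
    -- + 0`.
    refine hk₀ _ _ k 0 hk.1 hk.2 (fun a ha b hb => ?_) (fun a ha b hb => ?_) fun a ha b hb =>
      hadd k a ha b hb
    · obtain ⟨c, hc⟩ := hk.2
      simpa using S₃.sub_mem_differences (hadd k a ha c hc) (hadd k b hb c hc)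
    · obtain ⟨c, hc⟩ := hk.1
      simpa using S₃.sub_mem_differences (hadd k c hc a ha) (hadd k c hc b hb)
  -- In smaller rank `σ₃ = 0`; the levels of `S₁` and `S₂` embed by translation into those of `S₃`,
  -- so all three coefficients vanish.
  · obtain rfl := tendsto_nhds_unique hσ₃ (tendsto_zero_of_forall_smul_notMem h₃ he)
    have hz : (0 : ℝ) ^ (n : ℝ)⁻¹ = 0 := Real.zero_rpow (by positivity)
    have h1 : σ₁ ≤ 0 := by
      refine le_of_tendsto_of_tendsto hσ₁ hσ₃ ?_
      filter_upwards [hlarge] with k hk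
      obtain ⟨c, hc⟩ := hk.2
      refine div_le_div_of_nonneg_right ?_ (by positivity)
      exact_mod_cast card_le_card_of_injOn (· + c) (fun a ha => hadd k a ha c hc)
        (add_left_injective c).injOn
    have h2 : σ₂ ≤ 0 := by
      refine le_of_tendsto_of_tendsto hσ₂ hσ₃ ?_
      filter_upwards [hlarge] with k hk
      obtain ⟨c, hc⟩ := hk.1
      refine div_le_div_of_nonneg_right ?_ (by positivity)
      exact_mod_cast card_le_card_of_injOn (c + ·) (fun a ha => hadd k c hc a ha)
        (add_right_injective c).injOn
    have h1' : 0 ≤ σ₁ := ge_of_tendsto' hσ₁ fun k => by positivity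
    have h2' : 0 ≤ σ₂ := ge_of_tendsto' hσ₂ fun k => by positivity
    rw [le_antisymm h1 h1', le_antisymm h2 h2', hz, add_zero]

end LevelSemigroup

/-! ### Semigroups with multiplicities -/

/-- Multiplicities on a semigroup in `ℕ × Γ` that grow under translation by elements of the
semigroup. -/
structure WeightedSemigroup (Γ : Type*) [AddCommGroup Γ] where
  /-- The multiplicities in a given degree. -/
  weight : ℕ → Γ →₀ ℕ
  weight_le_add : ∀ {i j a}, a ∈ (weight i).support → ∀ b, weight j b ≤ weight (i + j) (a + b)
  bounded : ∃ d, ∀ k a, weight k a ≤ d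
  /-- A degree from which on all levels are non-empty. -/
  start : ℕ
  nonempty : ∀ j ≥ start, (weight j).support.Nonempty

namespace WeightedSemigroup

variable {Γ : Type*} [AddCommGroup Γ]

/-- The support of a weighted semigroup. -/
def toLevelSemigroup (W : WeightedSemigroup Γ) : LevelSemigroup Γ where
  level k := (W.weight k).support
  add_mem {i j a b} ha hb := by
    have := W.weight_le_add ha b (j := j)
    rw [Finsupp.mem_support_iff] at hb ⊢
    omega
  start := W.start
  nonempty := W.nonempty

/-- The sum of the multiplicities in degree `k`. -/
def total (W : WeightedSemigroup Γ) (k : ℕ) : ℕ := ∑ a ∈ (W.weight k).support, W.weight k a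

theorem exists_max_weight (W : WeightedSemigroup Γ) :
    ∃ D : ℕ, (∀ k a, W.weight k a ≤ D) ∧ ∃ k a, W.weight k a = D ∧ D ≠ 0 := by
  have hfin : BddAbove (Set.range fun x : ℕ × Γ => W.weight x.1 x.2) := by
    obtain ⟨d, hd⟩ := W.bounded
    exact ⟨d, by rintro _ ⟨x, rfl⟩; exact hd _ _⟩
  obtain ⟨⟨k, a⟩, hka⟩ := Nat.sSup_mem (Set.range_nonempty _) hfin
  refine ⟨_, fun k a => le_csSup hfin ⟨(k, a), rfl⟩, k, a, hka, ?_⟩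
  obtain ⟨b, hb⟩ := W.nonempty W.start le_rfl
  have := le_csSup hfin ⟨(W.start, b), rfl⟩
  rw [Finsupp.mem_support_iff] at hb
  simp only at this
  omega

/-- Translation by a point of degree `k₀` and maximal multiplicity `D` sends every point of the
`k`-th level to one of multiplicity `D`. So the total in degree `k + k₀` lies between `D` times the
sizes of the levels `k` and `k + k₀`. -/
theorem tendsto_total (W : WeightedSemigroup Γ) {n D : ℕ} (hD : ∀ k a, W.weight k a ≤ D)
    (hex : ∃ k a, W.weight k a = D ∧ D ≠ 0) {σ : ℝ}
    (hσ : Tendsto (fun k : ℕ => (#(W.toLevelSemigroup.level k) : ℝ) / (k : ℝ) ^ n) atTop (𝓝 σ)) :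
    Tendsto (fun k : ℕ => (W.total k : ℝ) / (k : ℝ) ^ n) atTop (𝓝 (D * σ)) := by
  obtain ⟨k₀, a, ha, hD0⟩ := hex
  have hup : ∀ k, W.total k ≤ D * #(W.toLevelSemigroup.level k) := fun k => by
    rw [mul_comm, ← smul_eq_mul]
    exact sum_le_card_nsmul _ _ _ fun b _ => hD k b
  have hlow : ∀ k, D * #(W.toLevelSemigroup.level k) ≤ W.total (k + k₀) := fun k => by
    classical
    have hw : ∀ b ∈ (W.weight k).support, W.weight (k + k₀) (b + a) = D := fun b hb =>
      le_antisymm (hD _ _) (ha.ge.trans (W.weight_le_add hb a))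
    calc D * #(W.toLevelSemigroup.level k)
        = ∑ b ∈ (W.weight k).support, W.weight (k + k₀) (b + a) := by
          rw [sum_congr rfl hw, sum_const, smul_eq_mul, mul_comm]
          rfl
      _ = ∑ b ∈ (W.weight k).support.image (· + a), W.weight (k + k₀) b := by
          rw [sum_image (add_left_injective a).injOn]
      _ ≤ W.total (k + k₀) := by
          refine sum_le_sum_of_subset fun b hb => ?_
          obtain ⟨c, hc, rfl⟩ := mem_image.1 hb
          rw [Finsupp.mem_support_iff, hw c hc]
          exact hD0
  have h1 : Tendsto (fun k : ℕ => D * ((#(W.toLevelSemigroup.level k) : ℝ) / (k : ℝ) ^ n)) atTop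
      (𝓝 (D * σ)) := hσ.const_mul _
  have h2 := ((tendsto_div_pow_add_iff (f := fun k => (#(W.toLevelSemigroup.level k) : ℝ))
    n k₀).2 hσ).const_mul (D : ℝ)
  rw [← tendsto_div_pow_add_iff n k₀]
  refine tendsto_of_tendsto_of_tendsto_of_le_of_le h1 h2 (fun k => ?_) (fun k => ?_)
  · simp only
    rw [← mul_div_assoc]
    exact div_le_div_of_nonneg_right (by exact_mod_cast hlow k) (by positivity)
  · simp only
    rw [← mul_div_assoc]
    exact div_le_div_of_nonneg_right (by exact_mod_cast hup _) (by positivity)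

/-- The Brunn–Minkowski inequality for the growth of weighted semigroups in `ℕ × Γ`, where `Γ` is
free of rank `n`. -/
theorem exists_growth_and_rpow_add_rpow_le [Module.Free ℤ Γ] [Module.Finite ℤ Γ] {n : ℕ}
    (hn : n ≠ 0) (hΓ : Module.finrank ℤ Γ = n) (W₁ W₂ W₃ : WeightedSemigroup Γ)
    (h₁ : W₁.toLevelSemigroup.HasGrowth n) (h₂ : W₂.toLevelSemigroup.HasGrowth n)
    (h₃ : W₃.toLevelSemigroup.HasGrowth n)
    (h₁₃ : ∀ k a b, b ∈ (W₂.weight k).support → W₁.weight k a ≤ W₃.weight k (a + b))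
    (h₂₃ : ∀ k a b, a ∈ (W₁.weight k).support → W₂.weight k b ≤ W₃.weight k (a + b)) :
    ∃ ρ₁ ρ₂ ρ₃ : NNReal,
      Tendsto (fun k : ℕ => (W₁.total k : ℝ) / (k : ℝ) ^ n) atTop (𝓝 ρ₁) ∧
      Tendsto (fun k : ℕ => (W₂.total k : ℝ) / (k : ℝ) ^ n) atTop (𝓝 ρ₂) ∧
      Tendsto (fun k : ℕ => (W₃.total k : ℝ) / (k : ℝ) ^ n) atTop (𝓝 ρ₃) ∧
      ρ₁ ^ (n : ℝ)⁻¹ + ρ₂ ^ (n : ℝ)⁻¹ ≤ ρ₃ ^ (n : ℝ)⁻¹ := by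
  obtain ⟨D₁, hD₁, k₁, a₁, hk₁, hp₁⟩ := W₁.exists_max_weight
  obtain ⟨D₂, hD₂, k₂, a₂, hk₂, hp₂⟩ := W₂.exists_max_weight
  obtain ⟨D₃, hD₃, hE₃⟩ := W₃.exists_max_weight
  obtain ⟨σ₁, hσ₁⟩ := h₁.exists_tendsto hn hΓ
  obtain ⟨σ₂, hσ₂⟩ := h₂.exists_tendsto hn hΓ
  obtain ⟨σ₃, hσ₃⟩ := h₃.exists_tendsto hn hΓ
  have h1 : 0 ≤ σ₁ := ge_of_tendsto' hσ₁ fun k => by positivity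
  have h2 : 0 ≤ σ₂ := ge_of_tendsto' hσ₂ fun k => by positivity
  have h3 : 0 ≤ σ₃ := ge_of_tendsto' hσ₃ fun k => by positivity
  -- The maximum of `W₁` may occur in a degree where `W₂` is empty, so it is first translated to a
  -- later degree.
  have hD₁₃ : D₁ ≤ D₃ := by
    obtain ⟨b, hb⟩ := W₂.nonempty (W₁.start + W₂.start + k₁) (by omega)
    obtain ⟨c, hc⟩ := W₁.nonempty (W₁.start + W₂.start) (by omega)
    exact (hk₁.ge.trans (W₁.weight_le_add hc a₁)).trans ((h₁₃ _ _ _ hb).trans (hD₃ _ _))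
  have hD₂₃ : D₂ ≤ D₃ := by
    obtain ⟨b, hb⟩ := W₁.nonempty (W₁.start + W₂.start + k₂) (by omega)
    obtain ⟨c, hc⟩ := W₂.nonempty (W₁.start + W₂.start) (by omega)
    exact (hk₂.ge.trans (W₂.weight_le_add hc a₂)).trans ((h₂₃ _ _ _ hb).trans (hD₃ _ _))
  have hBM := LevelSemigroup.rpow_add_rpow_le hn hΓ h₃ (fun k a ha b hb => by
    have := h₁₃ k a b hb
    simp only [toLevelSemigroup, Finsupp.mem_support_iff] at ha ⊢
    omega) hσ₁ hσ₂ hσ₃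
  lift σ₁ to NNReal using h1
  lift σ₂ to NNReal using h2
  lift σ₃ to NNReal using h3
  refine ⟨D₁ * σ₁, D₂ * σ₂, D₃ * σ₃, mod_cast W₁.tendsto_total hD₁ ⟨k₁, a₁, hk₁, hp₁⟩ hσ₁,
    mod_cast W₂.tendsto_total hD₂ ⟨k₂, a₂, hk₂, hp₂⟩ hσ₂, mod_cast W₃.tendsto_total hD₃ hE₃ hσ₃, ?_⟩
  have hBM' : σ₁ ^ (n : ℝ)⁻¹ + σ₂ ^ (n : ℝ)⁻¹ ≤ σ₃ ^ (n : ℝ)⁻¹ := by exact_mod_cast hBM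
  calc (D₁ * σ₁) ^ (n : ℝ)⁻¹ + (D₂ * σ₂) ^ (n : ℝ)⁻¹
      ≤ (D₃ * σ₁) ^ (n : ℝ)⁻¹ + (D₃ * σ₂) ^ (n : ℝ)⁻¹ := by gcongr
    _ = (D₃ : NNReal) ^ (n : ℝ)⁻¹ * (σ₁ ^ (n : ℝ)⁻¹ + σ₂ ^ (n : ℝ)⁻¹) := by
        rw [NNReal.mul_rpow, NNReal.mul_rpow, mul_add]
    _ ≤ (D₃ : NNReal) ^ (n : ℝ)⁻¹ * σ₃ ^ (n : ℝ)⁻¹ := by gcongr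
    _ = (D₃ * σ₃) ^ (n : ℝ)⁻¹ := by rw [NNReal.mul_rpow]

end WeightedSemigroup

end

/-! ### Leaves of a valuation and finite extensions -/

section

open Finset Module

section Leaves

variable {𝕜 E Γ₀ : Type*} [Field 𝕜] [Field E] [Algebra 𝕜 E] [LinearOrderedCommGroupWithZero Γ₀]

/-- The valuation `v` is trivial on the ground field. -/
def IsTrivialOver (𝕜 : Type*) {E Γ₀ : Type*} [Field 𝕜] [Field E] [Algebra 𝕜 E]
    [LinearOrderedCommGroupWithZero Γ₀] (v : Valuation E Γ₀) : Prop :=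
  ∀ c : 𝕜, v (algebraMap 𝕜 E c) ≤ 1

namespace IsTrivialOver

variable {v : Valuation E Γ₀} (hv : IsTrivialOver 𝕜 v)
include hv

lemma map_smul_le (c : 𝕜) (x : E) : v (c • x) ≤ v x := by
  rw [Algebra.smul_def, map_mul]
  exact mul_le_of_le_one_left' (hv c)

/-- The elements of value at most `γ`. -/
def closedBall (γ : Γ₀ˣ) : Submodule 𝕜 E where
  carrier := {x | v x ≤ γ}
  zero_mem' := by simp
  add_mem' ha hb := v.map_add_le ha hb
  smul_mem' c x hx := (hv.map_smul_le c x).trans hx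

/-- The elements of value less than `γ`. -/
def openBall (γ : Γ₀ˣ) : Submodule 𝕜 E where
  carrier := {x | v x < γ}
  zero_mem' := by simp
  add_mem' ha hb := v.map_add_lt ha hb
  smul_mem' c x hx := (hv.map_smul_le c x).trans_lt hx

lemma openBall_le_closedBall (γ : Γ₀ˣ) : hv.openBall γ ≤ hv.closedBall γ := fun _ hx => le_of_lt hx

/-- The image of `L` in the graded piece of value `γ`. -/
def leaf (L : Submodule 𝕜 E) (γ : Γ₀ˣ) : Submodule 𝕜 (E ⧸ hv.openBall γ) :=
  (L ⊓ hv.closedBall γ).map (hv.openBall γ).mkQ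

lemma finrank_inf_closedBall (L : Submodule 𝕜 E) [FiniteDimensional 𝕜 L] (γ : Γ₀ˣ) :
    finrank 𝕜 ↥(L ⊓ hv.closedBall γ) =
      finrank 𝕜 (hv.leaf L γ) + finrank 𝕜 ↥(L ⊓ hv.openBall γ) := by
  have h := LinearMap.finrank_range_add_finrank_ker
    ((hv.openBall γ).mkQ.domRestrict (L ⊓ hv.closedBall γ))
  rw [LinearMap.range_domRestrict] at h
  rw [← h, leaf]
  congr 1
  have : (LinearMap.ker ((hv.openBall γ).mkQ.domRestrict (L ⊓ hv.closedBall γ))).map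
      (L ⊓ hv.closedBall γ).subtype = L ⊓ hv.openBall γ := by
    ext x
    simp only [Submodule.mem_map, LinearMap.mem_ker, LinearMap.domRestrict_apply,
      Submodule.mkQ_apply, Submodule.Quotient.mk_eq_zero, Submodule.subtype_apply, Subtype.exists,
      exists_and_right, exists_eq_right, Submodule.mem_inf]
    constructor
    · rintro ⟨⟨h1, _⟩, h2⟩; exact ⟨h1, h2⟩
    · rintro ⟨h1, h2⟩; exact ⟨⟨h1, hv.openBall_le_closedBall γ h2⟩, h2⟩
  rw [← this]
  exact (Submodule.equivMapOfInjective (L ⊓ hv.closedBall γ).subtype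
    (Submodule.subtype_injective _) (LinearMap.ker
      ((hv.openBall γ).mkQ.domRestrict (L ⊓ hv.closedBall γ)))).finrank_eq

instance (L : Submodule 𝕜 E) [FiniteDimensional 𝕜 L] (γ : Γ₀ˣ) :
    FiniteDimensional 𝕜 (hv.leaf L γ) := by
  unfold leaf; infer_instance

lemma finrank_leaf_pos_iff {L : Submodule 𝕜 E} [FiniteDimensional 𝕜 L] {γ : Γ₀ˣ} :
    0 < finrank 𝕜 (hv.leaf L γ) ↔ ∃ x ∈ L, v x = γ := by
  rw [pos_iff_ne_zero, ne_eq, Submodule.finrank_eq_zero, leaf, ← le_bot_iff,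
    Submodule.map_le_iff_le_comap, Submodule.comap_bot, Submodule.ker_mkQ, SetLike.not_le_iff_exists]
  refine exists_congr fun x => ?_
  change (x ∈ L ∧ v x ≤ γ) ∧ ¬ v x < γ ↔ _
  rw [not_lt, and_assoc, le_antisymm_iff]

/-- Truncating `L` strictly below `m` does not affect smaller values; this drives the inductions
that peel off the largest value. -/
lemma leaf_inf_openBall (L : Submodule 𝕜 E) {γ m : Γ₀ˣ} (h : γ < m) :
    hv.leaf (L ⊓ hv.openBall m) γ = hv.leaf L γ := by
  unfold leaf
  congr 1
  ext x
  simp only [Submodule.mem_inf]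
  refine ⟨fun hx => ⟨hx.1.1, hx.2⟩, fun hx => ⟨⟨hx.1, ?_⟩, hx.2⟩⟩
  exact lt_of_le_of_lt (show v x ≤ γ from hx.2) (Units.val_lt_val.2 h)

lemma sum_finrank_leaf_le (s : Finset Γ₀ˣ) : ∀ (L : Submodule 𝕜 E) [FiniteDimensional 𝕜 L],
    ∑ γ ∈ s, finrank 𝕜 (hv.leaf L γ) ≤ finrank 𝕜 L := by
  induction s using Finset.induction_on_max with
  | empty => simp
  | insert m s hm ih =>
    intro L _
    rw [sum_insert fun h => lt_irrefl _ (hm m h)]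
    have h1 := hv.finrank_inf_closedBall L m
    have h2 : finrank 𝕜 ↥(L ⊓ hv.closedBall m) ≤ finrank 𝕜 L := Submodule.finrank_mono inf_le_left
    have h3 := ih (L ⊓ hv.openBall m)
    rw [sum_congr rfl fun γ hγ => by rw [hv.leaf_inf_openBall L (hm γ hγ)]] at h3
    omega

lemma finrank_le_sum_finrank_leaf (s : Finset Γ₀ˣ) : ∀ (L : Submodule 𝕜 E)
    [FiniteDimensional 𝕜 L], (∀ x ∈ L, x ≠ 0 → ∃ γ ∈ s, v x = γ) →
    finrank 𝕜 L ≤ ∑ γ ∈ s, finrank 𝕜 (hv.leaf L γ) := by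
  induction s using Finset.induction_on_max with
  | empty =>
    intro L _ h
    have : L = ⊥ := by
      rw [Submodule.eq_bot_iff]
      intro x hx
      by_contra hne
      simpa using h x hx hne
    simp [this]
  | insert m s hm ih =>
    intro L _ h
    rw [sum_insert fun h => lt_irrefl _ (hm m h)]
    have h1 := hv.finrank_inf_closedBall L m
    have h2 : L ⊓ hv.closedBall m = L := by
      refine inf_eq_left.2 fun x hx => ?_
      change v x ≤ m
      by_cases hne : x = 0
      · simp [hne]
      · obtain ⟨γ, hγ, hx'⟩ := h x hx hne
        rw [hx', Units.val_le_val]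
        rcases mem_insert.1 hγ with rfl | hγ
        exacts [le_rfl, (hm γ hγ).le]
    have h3 := ih (L ⊓ hv.openBall m) fun x hx hne => by
      obtain ⟨γ, hγ, hx'⟩ := h x hx.1 hne
      rcases mem_insert.1 hγ with rfl | hγ
      · exact absurd (show v x < γ from hx.2) (by rw [hx']; exact lt_irrefl _)
      · exact ⟨γ, hγ, hx'⟩
    rw [sum_congr rfl fun γ hγ => by rw [hv.leaf_inf_openBall L (hm γ hγ)]] at h3
    rw [h2] at h1
    omega

lemma finite_support_finrank_leaf (L : Submodule 𝕜 E) [FiniteDimensional 𝕜 L] :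
    (Function.support fun γ => finrank 𝕜 (hv.leaf L γ)).Finite := by
  by_contra hinf
  obtain ⟨t, ht, hcard⟩ := Set.Infinite.exists_subset_card_eq hinf (finrank 𝕜 L + 1)
  have h1 := hv.sum_finrank_leaf_le t L
  have h2 : #t • 1 ≤ ∑ γ ∈ t, finrank 𝕜 (hv.leaf L γ) :=
    card_nsmul_le_sum _ _ _ fun γ hγ => Nat.one_le_iff_ne_zero.2 (ht hγ)
  simp only [smul_eq_mul, mul_one] at h2
  omega

/-- The dimensions of the leaves of `L`. -/
noncomputable def leafDim (L : Submodule 𝕜 E) [FiniteDimensional 𝕜 L] : Additive Γ₀ˣ →₀ ℕ :=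
  Finsupp.ofSupportFinite (fun γ => finrank 𝕜 (hv.leaf L γ.toMul)) (hv.finite_support_finrank_leaf L)

lemma mem_support_leafDim {L : Submodule 𝕜 E} [FiniteDimensional 𝕜 L] {γ : Additive Γ₀ˣ} :
    γ ∈ (hv.leafDim L).support ↔ ∃ x ∈ L, v x = (γ.toMul : Γ₀ˣ) := by
  rw [← hv.finrank_leaf_pos_iff, Finsupp.mem_support_iff, pos_iff_ne_zero]
  rfl

lemma sum_leafDim (L : Submodule 𝕜 E) [FiniteDimensional 𝕜 L] :
    ∑ γ ∈ (hv.leafDim L).support, hv.leafDim L γ = finrank 𝕜 L := by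
  refine le_antisymm (hv.sum_finrank_leaf_le (hv.leafDim L).support L)
    (hv.finrank_le_sum_finrank_leaf (hv.leafDim L).support L fun x hx hne => ?_)
  have hx0 : v x ≠ 0 := (map_ne_zero v).2 hne
  exact ⟨Units.mk0 _ hx0, hv.mem_support_leafDim.2 ⟨x, hx, rfl⟩, rfl⟩

lemma card_support_leafDim_le (L : Submodule 𝕜 E) [FiniteDimensional 𝕜 L] :
    #(hv.leafDim L).support ≤ finrank 𝕜 L := by
  rw [← hv.sum_leafDim L, card_eq_sum_ones]
  exact sum_le_sum fun γ hγ => Nat.one_le_iff_ne_zero.2 (Finsupp.mem_support_iff.1 hγ)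

/-- Multiplication by `a` shifts values by exactly `α`, hence is injective from the graded piece at
`γ` to the one at `α + γ`. -/
lemma leafDim_le_leafDim_add {L M : Submodule 𝕜 E} [FiniteDimensional 𝕜 L] [FiniteDimensional 𝕜 M]
    {a : E} {α : Additive Γ₀ˣ} (ha : v a = (α.toMul : Γ₀ˣ)) (h : ∀ x ∈ L, a * x ∈ M)
    (γ : Additive Γ₀ˣ) : hv.leafDim L γ ≤ hv.leafDim M (α + γ) := by
  set f : E →ₗ[𝕜] E := LinearMap.mulLeft 𝕜 a with hf
  have hpos : (0 : Γ₀) < (α.toMul : Γ₀ˣ) := zero_lt_iff.2 (Units.ne_zero _)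
  have hmem : ∀ x, v (a * x) < ((α + γ).toMul : Γ₀ˣ) ↔ v x < (γ.toMul : Γ₀ˣ) := fun x => by
    rw [map_mul, ha, toMul_add, Units.val_mul]
    exact mul_lt_mul_iff_right₀ hpos
  have hcomap : hv.openBall γ.toMul = (hv.openBall (α + γ).toMul).comap f := by
    ext x
    exact (hmem x).symm
  set g := (hv.openBall γ.toMul).mapQ (hv.openBall (α + γ).toMul) f hcomap.le with hg
  have hinj : Function.Injective g := by
    rw [← LinearMap.ker_eq_bot, hg, Submodule.ker_mapQ, ← hcomap, Submodule.mkQ_map_self]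
  have hle : (hv.leaf L γ.toMul).map g ≤ hv.leaf M (α + γ).toMul := by
    rintro _ ⟨_, ⟨x, hx, rfl⟩, rfl⟩
    refine ⟨a * x, ⟨h x hx.1, ?_⟩, rfl⟩
    change v (a * x) ≤ ((α + γ).toMul : Γ₀ˣ)
    rw [map_mul, ha, toMul_add, Units.val_mul]
    exact mul_le_mul_right (show v x ≤ (γ.toMul : Γ₀ˣ) from hx.2) _
  calc finrank 𝕜 (hv.leaf L γ.toMul) = finrank 𝕜 ((hv.leaf L γ.toMul).map g) :=
        (LinearEquiv.finrank_eq (Submodule.equivMapOfInjective g hinj _))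
    _ ≤ _ := Submodule.finrank_mono hle

end IsTrivialOver

end Leaves

section FiniteExtension

variable {𝕜 K E Γ₀ : Type*} [Field 𝕜] [Field K] [Field E] [Algebra 𝕜 K] [Algebra K E] [Algebra 𝕜 E]
  [IsScalarTower 𝕜 K E] [LinearOrderedCommGroupWithZero Γ₀] {v : Valuation E Γ₀}

/-- If the residue field of `K` is the ground field, then lifts of linearly independent elements of
a graded piece are linearly independent over `K`. -/
lemma IsTrivialOver.linearIndependent_of_mkQ (hv : IsTrivialOver 𝕜 v)
    (hres : ∀ u : K, v (algebraMap K E u) = 1 →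
      ∃ c : 𝕜, v (algebraMap K E (u - algebraMap 𝕜 K c)) < 1)
    {ι : Type*} [Finite ι] {γ : Γ₀ˣ} {x : ι → E} (hx : ∀ i, v (x i) ≤ γ)
    (hli : LinearIndependent 𝕜 fun i => (hv.openBall γ).mkQ (x i)) : LinearIndependent K x := by
  have := Fintype.ofFinite ι
  rw [Fintype.linearIndependent_iff] at hli ⊢
  intro c hc
  by_contra! hne
  obtain ⟨i₀, hi₀⟩ := hne
  -- Dividing by a coefficient of largest value makes all `c i / c j` integral. Their residues `a i`
  -- lie in `𝕜` and give a relation in the graded piece, with `a j ≠ 0`.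
  obtain ⟨j, -, hj⟩ := exists_max_image (univ : Finset ι) (fun i => v (algebraMap K E (c i)))
    ⟨i₀, mem_univ _⟩
  have hcj : c j ≠ 0 := by
    intro h0
    have := hj i₀ (mem_univ _)
    rw [h0, map_zero, map_zero, le_zero_iff, map_eq_zero, map_eq_zero] at this
    exact hi₀ this
  have hvj : 0 < v (algebraMap K E (c j)) := by
    rw [zero_lt_iff, ne_eq, map_eq_zero, map_eq_zero]; exact hcj
  have hu : ∀ i, ∃ a : 𝕜, v (algebraMap K E (c i / c j - algebraMap 𝕜 K a)) < 1 := fun i => by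
    have hle : v (algebraMap K E (c i / c j)) ≤ 1 := by
      rw [map_div₀, map_div₀, div_le_one₀ hvj]
      exact hj i (mem_univ _)
    rcases hle.eq_or_lt with h | h
    · exact hres _ h
    · exact ⟨0, by simpa using h⟩
  choose a ha using hu
  have hsum : ∑ i, a i • x i ∈ hv.openBall γ := by
    have h1 : ∑ i, a i • x i = - ∑ i, algebraMap K E (c i / c j - algebraMap 𝕜 K (a i)) * x i := by
      have h2 : ∑ i, algebraMap K E (c i / c j) * x i = 0 := by
        have : ∀ i, algebraMap K E (c i / c j) * x i = (algebraMap K E (c j))⁻¹ * (c i • x i) :=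
          fun i => by rw [map_div₀, Algebra.smul_def]; ring
        simp_rw [this, ← mul_sum, hc, mul_zero]
      simp only [map_sub, sub_mul, sum_sub_distrib, h2, zero_sub, neg_neg,
        ← IsScalarTower.algebraMap_apply, Algebra.smul_def]
    rw [h1, neg_mem_iff]
    refine Submodule.sum_mem _ fun i _ => ?_
    change v _ < _
    rw [map_mul]
    have hγ : (0 : Γ₀) < γ := zero_lt_iff.2 (Units.ne_zero _)
    calc _ ≤ v (algebraMap K E (c i / c j - algebraMap 𝕜 K (a i))) * γ := mul_le_mul_right (hx i) _
      _ < 1 * γ := by exact mul_lt_mul_of_pos_right (ha i) hγ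
      _ = γ := one_mul _
  have := hli a (by
    simp_rw [← map_smul, ← map_sum]
    exact (Submodule.Quotient.mk_eq_zero _).2 hsum) j
  have hlt := ha j
  rw [this, div_self hcj, map_zero, sub_zero, map_one, map_one] at hlt
  exact lt_irrefl _ hlt

/-- A basis of the leaf lifts to elements of `E` that are independent over `K`. -/
lemma IsTrivialOver.finrank_leaf_le [FiniteDimensional K E] (hv : IsTrivialOver 𝕜 v)
    (hres : ∀ u : K, v (algebraMap K E u) = 1 →
      ∃ c : 𝕜, v (algebraMap K E (u - algebraMap 𝕜 K c)) < 1)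
    (L : Submodule 𝕜 E) [FiniteDimensional 𝕜 L] (γ : Γ₀ˣ) :
    finrank 𝕜 (hv.leaf L γ) ≤ finrank K E := by
  obtain ⟨b⟩ : Nonempty (Basis (Fin (finrank 𝕜 (hv.leaf L γ))) 𝕜 (hv.leaf L γ)) :=
    ⟨finBasis 𝕜 _⟩
  have hb : ∀ i, ∃ x, v x ≤ γ ∧ (hv.openBall γ).mkQ x = (b i : E ⧸ hv.openBall γ) := fun i => by
    obtain ⟨x, hx, h⟩ := (b i).2
    exact ⟨x, hx.2, h⟩
  choose x hx hx' using hb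
  have hli : LinearIndependent 𝕜 fun i => (hv.openBall γ).mkQ (x i) := by
    rw [funext hx']
    exact b.linearIndependent.map' (hv.leaf L γ).subtype (Submodule.ker_subtype _)
  have := (hv.linearIndependent_of_mkQ hres hx hli).fintype_card_le_finrank
  rwa [Fintype.card_fin] at this

omit [Algebra 𝕜 K] [Algebra 𝕜 E] [IsScalarTower 𝕜 K E] [Field 𝕜] in
/-- Elements with values in distinct cosets of the value group of `K` are linearly independent
over `K`. -/
lemma Valuation.linearIndependent_of_div_ne {ι : Type*} [Finite ι] {x : ι → E}
    (hx : ∀ i, x i ≠ 0)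
    (hdiv : ∀ i j, i ≠ j → ∀ u : K, v (x i) ≠ v (algebraMap K E u) * v (x j)) :
    LinearIndependent K x := by
  classical
  have := Fintype.ofFinite ι
  rw [Fintype.linearIndependent_iff]
  intro c hc
  by_contra! hne
  obtain ⟨i₀, hi₀⟩ := hne
  obtain ⟨j, -, hj⟩ := exists_max_image (univ : Finset ι) (fun i => v (c i • x i))
    ⟨i₀, mem_univ _⟩
  have hpos : v (c j • x j) ≠ 0 := by
    intro h0
    have := hj i₀ (mem_univ _)
    simp only [h0, le_zero_iff, map_eq_zero, smul_eq_zero] at this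
    exact this.elim hi₀ (hx i₀)
  have hcj : c j ≠ 0 := by
    rintro h
    simp [h] at hpos
  have hlt : ∀ i ∈ univ.erase j, v (c i • x i) < v (c j • x j) := fun i hi => by
    refine lt_of_le_of_ne (hj i (mem_univ _)) fun h => ?_
    by_cases hci : c i = 0
    · rw [hci, zero_smul, map_zero] at h
      exact hpos h.symm
    refine hdiv i j (ne_of_mem_erase hi) (c j / c i) ?_
    have hvi : v (algebraMap K E (c i)) ≠ 0 := by
      rw [ne_eq, map_eq_zero, map_eq_zero]; exact hci
    rw [Algebra.smul_def, Algebra.smul_def, map_mul, map_mul] at h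
    rw [map_div₀, map_div₀, div_mul_eq_mul_div, ← h, mul_div_cancel_left₀ _ hvi]
  have h1 : v (∑ i ∈ univ.erase j, c i • x i) < v (c j • x j) := v.map_sum_lt hpos hlt
  rw [← add_sum_erase _ _ (mem_univ j), add_eq_zero_iff_eq_neg] at hc
  rw [hc, v.map_neg] at h1
  exact lt_irrefl _ h1

omit [Algebra 𝕜 K] [Algebra 𝕜 E] [IsScalarTower 𝕜 K E] [Field 𝕜] in
/-- The value group of a finite extension of `K` is free of rank `n` if that of `K` is. -/
theorem Valuation.free_and_finrank_eq [FiniteDimensional K E] (hsurj : Function.Surjective v)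
    {n : ℕ} {g : Fin n → Additive Γ₀ˣ} (hg : LinearIndependent ℤ g)
    (hspan : ∀ u : K, u ≠ 0 → ∃ γ ∈ Submodule.span ℤ (Set.range g),
      v (algebraMap K E u) = ((Additive.toMul γ : Γ₀ˣ) : Γ₀)) :
    Module.Finite ℤ (Additive Γ₀ˣ) ∧ Module.Free ℤ (Additive Γ₀ˣ) ∧
      finrank ℤ (Additive Γ₀ˣ) = n := by
  classical
  set N := Submodule.span ℤ (Set.range g) with hN
  -- `N` contains the values of `K`, so elements with values in distinct cosets of `N` are
  -- independent over `K`: there are at most `[E : K]` cosets.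
  have hfin : Finite (Additive Γ₀ˣ ⧸ N) := by
    by_contra hinf
    rw [not_finite_iff_infinite] at hinf
    obtain ⟨t, ht⟩ := Infinite.exists_subset_card_eq (Additive Γ₀ˣ ⧸ N) (finrank K E + 1)
    have hlift : ∀ q : t, ∃ y : E, y ≠ 0 ∧ ∃ γ : Additive Γ₀ˣ, N.mkQ γ = q ∧
        v y = ((Additive.toMul γ : Γ₀ˣ) : Γ₀) := fun q => by
      obtain ⟨γ, hγ⟩ := N.mkQ_surjective q
      obtain ⟨y, hy⟩ := hsurj ((Additive.toMul γ : Γ₀ˣ) : Γ₀)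
      refine ⟨y, ?_, γ, hγ, hy⟩
      rintro rfl
      rw [map_zero] at hy
      exact (Units.ne_zero _) hy.symm
    choose y hy γ hγ hyγ using hlift
    have hli : LinearIndependent K y := by
      refine Valuation.linearIndependent_of_div_ne (v := v) hy fun i j hij u hu => hij ?_
      have hu0 : u ≠ 0 := by
        rintro rfl
        rw [map_zero, map_zero, zero_mul, map_eq_zero] at hu
        exact hy i hu
      obtain ⟨δ, hδ, huδ⟩ := hspan u hu0
      rw [hyγ, hyγ, huδ, ← Units.val_mul, Units.val_inj, ← toMul_add] at hu
      have hu' : γ i = δ + γ j := Additive.toMul.injective hu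
      have : N.mkQ (γ i) = N.mkQ (γ j) := by
        have hδ' : N.mkQ δ = 0 := (Submodule.Quotient.mk_eq_zero N).2 hδ
        rw [hu', map_add, hδ', zero_add]
      rw [hγ, hγ] at this
      exact Subtype.ext this
    have := hli.fintype_card_le_finrank
    rw [Fintype.card_coe, ht] at this
    omega
  have hNfin : Module.Finite ℤ N := Module.Finite.span_of_finite ℤ (Set.finite_range g)
  have h1 : Module.Finite ℤ (Additive Γ₀ˣ) := Module.Finite.of_submodule_quotient N
  -- A linearly ordered group is torsion-free, hence free once finitely generated.
  have h2 : Module.Free ℤ (Additive Γ₀ˣ) := inferInstance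
  refine ⟨h1, h2, ?_⟩
  have h3 := N.finrank_quotient_add_finrank
  have h4 : finrank ℤ (Additive Γ₀ˣ ⧸ N) = 0 := by
    rw [Module.finrank_eq_zero_iff_isTorsion]
    intro x
    obtain ⟨m, hm, hx⟩ := (isOfFinAddOrder_of_finite x).exists_nsmul_eq_zero
    refine ⟨⟨m, mem_nonZeroDivisors_of_ne_zero (by exact_mod_cast hm.ne')⟩, ?_⟩
    rw [Submonoid.mk_smul, natCast_zsmul, hx]
  rw [← h3, h4, zero_add, hN, finrank_span_eq_card hg, Fintype.card_fin]

end FiniteExtension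

end

/-! ### A valuation of rank `n` on a finite extension -/

section

open Finset Module

namespace ValuationSubring

/-- Every valuation ring of a subfield is dominated by a valuation ring of the field. -/
lemma exists_dominating {K E : Type*} [Field K] [Field E] [Algebra K E] (W : ValuationSubring K) :
    ∃ V : ValuationSubring E, (∀ u ∈ W, algebraMap K E u ∈ V) ∧
      ∀ u ∈ W, (algebraMap K E u)⁻¹ ∈ V → u⁻¹ ∈ W := by
  obtain ⟨V, hle, hloc⟩ := (W.toLocalSubring.map (algebraMap K E)).exists_le_valuationSubring
  refine ⟨V, fun u hu => hle ⟨u, hu, rfl⟩, fun u hu hinv => ?_⟩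
  by_cases h0 : u = 0
  · rw [h0, inv_zero]
    exact W.zero_mem
  have h0' : algebraMap K E u ≠ 0 := by rwa [ne_eq, map_eq_zero]
  have hmem : algebraMap K E u ∈ (W.toLocalSubring.map (algebraMap K E)).toSubring := ⟨u, hu, rfl⟩
  have hunit : IsUnit (⟨algebraMap K E u, hmem⟩ :
      (W.toLocalSubring.map (algebraMap K E)).toSubring) := by
    refine hloc.map_nonunit _ (isUnit_iff_exists_inv.2 ⟨⟨_, hinv⟩, ?_⟩)
    exact Subtype.ext (mul_inv_cancel₀ h0')
  obtain ⟨⟨_, w, hw, rfl⟩, h⟩ := isUnit_iff_exists_inv.1 hunit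
  have h1 : algebraMap K E u * algebraMap K E w = 1 := congrArg Subtype.val h
  rw [← map_mul, ← map_one (algebraMap K E)] at h1
  rw [inv_eq_of_mul_eq_one_right ((algebraMap K E).injective h1)]
  exact hw

end ValuationSubring

section Monomial

variable {𝕜 Γ : Type*} [Field 𝕜] [AddCommGroup Γ] [LinearOrder Γ] [IsOrderedAddMonoid Γ] {n : ℕ}

lemma HahnSeries.prod_single_one {ι : Type*} (s : Finset ι) (f : ι → Γ) :
    ∏ i ∈ s, (HahnSeries.single (f i) (1 : 𝕜)) = HahnSeries.single (∑ i ∈ s, f i) 1 := by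
  classical
  induction s using Finset.induction_on with
  | empty => simp
  | insert i s hi ih => rw [prod_insert hi, sum_insert hi, ih, HahnSeries.single_mul_single, one_mul]

/-- The homomorphism from polynomials to Hahn series that sends the variables to `t ^ b i`. -/
noncomputable def monomialHom (𝕜 : Type*) [Field 𝕜] (b : Fin n → Γ) :
    MvPolynomial (Fin n) 𝕜 →ₐ[𝕜] HahnSeries Γ 𝕜 :=
  MvPolynomial.aeval fun i => HahnSeries.single (b i) (1 : 𝕜)

lemma monomialHom_monomial (b : Fin n → Γ) (m : Fin n →₀ ℕ) (c : 𝕜) :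
    monomialHom 𝕜 b (MvPolynomial.monomial m c) = HahnSeries.single (∑ i, m i • b i) c := by
  rw [monomialHom, MvPolynomial.aeval_monomial, Finsupp.prod_fintype _ _ (by simp)]
  simp_rw [HahnSeries.single_pow, one_pow]
  rw [HahnSeries.prod_single_one, HahnSeries.algebraMap_apply, Algebra.algebraMap_self,
    RingHom.id_apply, HahnSeries.C_apply, HahnSeries.single_mul_single, zero_add, mul_one]

/-- Independence of `b` gives distinct monomials distinct exponents, so the coefficients of `p` can
be read off its image. -/
lemma monomialHom_injective (b : Basis (Fin n) ℤ Γ) : Function.Injective (monomialHom 𝕜 b) := by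
  have hinj : Function.Injective fun m : Fin n →₀ ℕ => ∑ i, m i • b i := by
    intro m m' h
    ext j
    have h1 : ∀ m : Fin n →₀ ℕ, b.repr (∑ i, m i • b i) j = m j := fun m => by
      simp only [map_sum, map_nsmul, Basis.repr_self, Finsupp.coe_finsetSum, Finset.sum_apply,
        Finsupp.smul_single, nsmul_eq_mul, mul_one]
      simp [Finsupp.single_apply]
    have h2 := h1 m
    simp only at h
    rw [h, h1] at h2
    exact_mod_cast h2.symm
  have hcoeff : ∀ (p : MvPolynomial (Fin n) 𝕜) (m : Fin n →₀ ℕ),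
      (monomialHom 𝕜 b p).coeff (∑ i, m i • b i) = p.coeff m := fun p m => by
    classical
    refine MvPolynomial.induction_on' p (fun m' c => ?_) fun p q hp hq => ?_
    · rw [monomialHom_monomial, MvPolynomial.coeff_monomial, HahnSeries.coeff_single]
      simp only [hinj.eq_iff (a := m) (b := m'), eq_comm]
    · rw [map_add, HahnSeries.coeff_add, hp, hq, MvPolynomial.coeff_add]
  rw [injective_iff_map_eq_zero]
  intro p hp
  ext m
  rw [← hcoeff, hp]
  simp

end Monomial

section Extension

variable {𝕜 K E Γ : Type*} [Field 𝕜] [Field K] [Field E] [Algebra 𝕜 K] [Algebra K E]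
  [Algebra 𝕜 E] [IsScalarTower 𝕜 K E] [AddCommGroup Γ] [LinearOrder Γ] [IsOrderedAddMonoid Γ]

lemma HahnSeries.order_inv {x : HahnSeries Γ 𝕜} (hx : x ≠ 0) : x⁻¹.order = -x.order := by
  rw [eq_neg_iff_add_eq_zero, ← HahnSeries.order_mul (inv_ne_zero hx) hx, inv_mul_cancel₀ hx,
    HahnSeries.order_one]

/-- The valuation ring of series of non-negative order, pulled back to a subfield. -/
def orderValuationSubring (i : K →+* HahnSeries Γ 𝕜) : ValuationSubring K where
  carrier := {u | 0 ≤ (i u).orderTop}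
  zero_mem' := by simp
  one_mem' := by simp
  add_mem' {u w} hu hw := by
    change 0 ≤ (i (u + w)).orderTop
    rw [map_add]
    exact (le_min hu hw).trans HahnSeries.min_orderTop_le_orderTop_add
  mul_mem' {u w} hu hw := by
    change 0 ≤ (i (u * w)).orderTop
    rw [map_mul, HahnSeries.orderTop_mul]
    exact add_nonneg hu hw
  neg_mem' {u} hu := by
    change 0 ≤ (i (-u)).orderTop
    rwa [map_neg, HahnSeries.orderTop_neg]
  mem_or_inv_mem' u := by
    change 0 ≤ (i u).orderTop ∨ 0 ≤ (i u⁻¹).orderTop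
    rw [HahnSeries.zero_le_orderTop_iff, HahnSeries.zero_le_orderTop_iff, map_inv₀]
    by_cases hu : i u = 0
    · simp [hu]
    · rw [HahnSeries.order_inv hu, neg_nonneg]
      exact le_total _ _

omit [Algebra 𝕜 K] in
lemma mem_orderValuationSubring {i : K →+* HahnSeries Γ 𝕜} {u : K} :
    u ∈ orderValuationSubring i ↔ 0 ≤ (i u).order :=
  HahnSeries.zero_le_orderTop_iff

/-- A finite extension of a rational function field in `n` variables has a valuation with free value
group of rank `n` whose restriction to the rational function field has the ground field as residue
field. -/
theorem exists_valuation {n : ℕ} (i : K →ₐ[𝕜] HahnSeries Γ 𝕜) (b : Basis (Fin n) ℤ Γ) (X : Fin n → K)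
    (hX : ∀ j, i (X j) = HahnSeries.single (b j) 1) [FiniteDimensional K E] :
    ∃ V : ValuationSubring E, IsTrivialOver 𝕜 V.valuation ∧
      (∀ u : K, V.valuation (algebraMap K E u) = 1 →
        ∃ c : 𝕜, V.valuation (algebraMap K E (u - algebraMap 𝕜 K c)) < 1) ∧
      Module.Finite ℤ (Additive V.ValueGroupˣ) ∧ Module.Free ℤ (Additive V.ValueGroupˣ) ∧
      finrank ℤ (Additive V.ValueGroupˣ) = n := by
  obtain ⟨V, hV₁, hV₂⟩ := (orderValuationSubring (i : K →+* HahnSeries Γ 𝕜)).exists_dominating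
    (E := E)
  have hi0 : ∀ {u : K}, u ≠ 0 → i u ≠ 0 := fun hu => by rwa [ne_eq, map_eq_zero]
  have hle : ∀ u : K, 0 ≤ (i u).order → V.valuation (algebraMap K E u) ≤ 1 := fun u hu =>
    (V.valuation_le_one_iff _).2 (hV₁ u (mem_orderValuationSubring.2 hu))
  -- Domination is what gives this: no element of `K` of positive order becomes a unit of `V`, so
  -- `V` induces on `K` the same units as the order.
  have hiff : ∀ u : K, u ≠ 0 → (V.valuation (algebraMap K E u) = 1 ↔ (i u).order = 0) := by
    intro u hu
    constructor
    · intro h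
      have hpos : ∀ w : K, w ≠ 0 → V.valuation (algebraMap K E w) = 1 → 0 ≤ (i w).order →
          (i w).order ≤ 0 := fun w hw hw1 hw0 => by
        have : w⁻¹ ∈ orderValuationSubring (i : K →+* HahnSeries Γ 𝕜) := by
          refine hV₂ w (mem_orderValuationSubring.2 hw0) ((V.valuation_le_one_iff _).1 ?_)
          rw [map_inv₀, hw1, inv_one]
        have := mem_orderValuationSubring.1 this
        change 0 ≤ (i w⁻¹).order at this
        rwa [map_inv₀, HahnSeries.order_inv (hi0 hw), neg_nonneg] at this
      rcases le_total 0 (i u).order with h0 | h0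
      · exact le_antisymm (hpos u hu h h0) h0
      · have h1 : (i u⁻¹).order = -(i u).order := by
          rw [map_inv₀, HahnSeries.order_inv (hi0 hu)]
        have h2 := hpos u⁻¹ (inv_ne_zero hu) (by rw [map_inv₀, map_inv₀, h, inv_one])
          (by rwa [h1, neg_nonneg])
        rw [h1, neg_nonpos] at h2
        exact le_antisymm h0 h2
    · intro h
      refine le_antisymm (hle u h.ge) ?_
      have h1 := hle u⁻¹ (by rw [map_inv₀, HahnSeries.order_inv (hi0 hu), h, neg_zero])
      have h2 : 0 < V.valuation (algebraMap K E u) := by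
        rw [zero_lt_iff, ne_eq, map_eq_zero, map_eq_zero]; exact hu
      rwa [map_inv₀, map_inv₀, inv_le_one₀ h2] at h1
  have hlt : ∀ u : K, 0 < (i u).orderTop → V.valuation (algebraMap K E u) < 1 := fun u hu => by
    refine lt_of_le_of_ne (hle u (HahnSeries.zero_le_orderTop_iff.1 hu.le)) fun h => ?_
    have hu0 : u ≠ 0 := by
      rintro rfl
      simp at h
    have := (hiff u hu0).1 h
    rw [HahnSeries.zero_lt_orderTop_iff (hi0 hu0), this] at hu
    exact lt_irrefl _ hu
  have hC : ∀ c : 𝕜, i (algebraMap 𝕜 K c) = HahnSeries.C c := fun c => by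
    rw [AlgHom.commutes, HahnSeries.algebraMap_apply, Algebra.algebraMap_self, RingHom.id_apply]
  refine ⟨V, fun c => ?_, fun u hu => ?_, ?_⟩
  · rw [IsScalarTower.algebraMap_apply 𝕜 K E]
    exact hle _ (by rw [hC, HahnSeries.order_C])
  · have hu0 : u ≠ 0 := by
      rintro rfl
      simp at hu
    have hord := (hiff u hu0).1 hu
    -- The residue of a series of order 0 is its constant coefficient; subtracting it leaves
    -- positive order.
    refine ⟨(i u).coeff 0, hlt _ (lt_of_le_of_ne ?_ (Ne.symm ?_))⟩
    · rw [map_sub, hC]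
      refine le_trans (le_min ?_ ?_) HahnSeries.min_orderTop_le_orderTop_sub
      · rw [HahnSeries.zero_le_orderTop_iff, hord]
      · rw [HahnSeries.zero_le_orderTop_iff, HahnSeries.order_C]
    · refine HahnSeries.orderTop_ne_of_coeff_eq_zero ?_
      rw [map_sub, hC, HahnSeries.coeff_sub, HahnSeries.C_apply, HahnSeries.coeff_single_same,
        sub_self]
  · have hX0 : ∀ j, X j ≠ 0 := fun j h => by
      have := hX j
      rw [h, map_zero] at this
      exact HahnSeries.single_ne_zero one_ne_zero this.symm
    let oHom : Additive Kˣ →+ Γ :=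
      { toFun := fun u => (i (u.toMul : Kˣ)).order
        map_zero' := by simp
        map_add' := fun u w => by
          rw [toMul_add, Units.val_mul, map_mul]
          exact HahnSeries.order_mul (hi0 (Units.ne_zero _)) (hi0 (Units.ne_zero _)) }
    let vHom : Additive Kˣ →+ Additive V.ValueGroupˣ :=
      (Units.map (V.valuation.comap (algebraMap K E)).toMonoidWithZeroHom.toMonoidHom).toAdditive
    -- Order and valuation have the same kernel on the units of `K`, so relations among values can
    -- be tested in `Γ`, where the `X j` have the basis `b` as orders.
    have hvo : ∀ u, vHom u = 0 ↔ oHom u = 0 := fun u => by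
      rw [← show _ ↔ oHom u = 0 from hiff (u.toMul : Kˣ) (Units.ne_zero _)]
      exact Units.ext_iff
    let X' : Fin n → Additive Kˣ := fun j => Additive.ofMul (Units.mk0 (X j) (hX0 j))
    have hoX : ∀ j, oHom (X' j) = b j := fun j => by
      change (i (X j)).order = b j
      rw [hX, HahnSeries.order_single one_ne_zero]
    refine Valuation.free_and_finrank_eq (K := K) V.valuation_surjective
      (g := fun j => vHom (X' j)) ?_ fun u hu => ?_
    · rw [Fintype.linearIndependent_iff]
      intro a ha
      simp_rw [← map_zsmul, ← map_sum] at ha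
      rw [hvo, map_sum] at ha
      simp_rw [map_zsmul, hoX] at ha
      exact Fintype.linearIndependent_iff.1 b.linearIndependent a ha
    · set u' : Additive Kˣ := Additive.ofMul (Units.mk0 u hu) with hu'
      have h : vHom (u' - ∑ j, b.repr (oHom u') j • X' j) = 0 := by
        rw [hvo, map_sub, map_sum]
        simp_rw [map_zsmul, hoX]
        rw [b.sum_repr, sub_self]
      rw [map_sub, sub_eq_zero, map_sum] at h
      refine ⟨vHom u', ?_, rfl⟩
      rw [h]
      refine Submodule.sum_mem _ fun j _ => ?_
      rw [map_zsmul]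
      exact Submodule.smul_mem _ _ (Submodule.subset_span ⟨j, rfl⟩)

/-- A finite extension of a rational function field in `n` variables over `𝕜` has a valuation with
free value group of rank `n` whose graded pieces have bounded dimension over `𝕜`. -/
theorem exists_valuation_finrank_leaf_le (n : ℕ) [Algebra (MvPolynomial (Fin n) 𝕜) K]
    [IsFractionRing (MvPolynomial (Fin n) 𝕜) K] [IsScalarTower 𝕜 (MvPolynomial (Fin n) 𝕜) K]
    [FiniteDimensional K E] :
    ∃ (V : ValuationSubring E) (hV : IsTrivialOver 𝕜 V.valuation),
      (∃ d, ∀ (L : Submodule 𝕜 E) [FiniteDimensional 𝕜 L] (γ : V.ValueGroupˣ),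
        finrank 𝕜 (hV.leaf L γ) ≤ d) ∧
      Module.Finite ℤ (Additive V.ValueGroupˣ) ∧ Module.Free ℤ (Additive V.ValueGroupˣ) ∧
      finrank ℤ (Additive V.ValueGroupˣ) = n := by
  -- The lexicographic order makes `ℤⁿ` a linearly ordered group, as the exponents of Hahn series
  -- require.
  let b : Basis (Fin n) ℤ (Lex (Fin n → ℤ)) := (Pi.basisFun ℤ (Fin n)).map (toLexLinearEquiv ℤ _)
  let i : K →ₐ[𝕜] HahnSeries (Lex (Fin n → ℤ)) 𝕜 :=
    IsFractionRing.liftAlgHom (g := monomialHom 𝕜 b) (monomialHom_injective b)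
  obtain ⟨V, h₁, h₂, h₃⟩ := exists_valuation (E := E) i b
    (fun j => algebraMap (MvPolynomial (Fin n) 𝕜) K (MvPolynomial.X j)) fun j => by
      simp only [i]
      rw [IsFractionRing.liftAlgHom_apply, IsFractionRing.lift_algebraMap]
      simp [monomialHom]
  exact ⟨V, h₁, ⟨finrank K E, fun L _ γ => h₁.finrank_leaf_le h₂ L γ⟩, h₃⟩

end Extension

end

/-! ### Polynomial growth of powers of a subspace -/

section

open Finset Module

section Growth

lemma MvPolynomial.finrank_restrictDegree_le (𝕜 : Type*) [Field 𝕜] (n D : ℕ) :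
    finrank 𝕜 (restrictDegree (Fin n) 𝕜 D) ≤ (D + 1) ^ n := by
  have h : finrank 𝕜 (restrictDegree (Fin n) 𝕜 D) =
      Nat.card {m : Fin n →₀ ℕ | ∀ i, m i ≤ D} :=
    finrank_eq_nat_card_basis (basisRestrictSupport 𝕜 {m : Fin n →₀ ℕ | ∀ i, m i ≤ D})
  rw [h]
  have hinj : Function.Injective fun (m : {m : Fin n →₀ ℕ | ∀ i, m i ≤ D}) (i : Fin n) =>
      (⟨m.1 i, Nat.lt_succ_of_le (m.2 i)⟩ : Fin (D + 1)) := by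
    intro m m' h
    ext i
    exact congrArg Fin.val (congrFun h i)
  refine (Nat.card_le_card_of_injective _ hinj).trans_eq ?_
  simp

lemma MvPolynomial.mul_mem_restrictDegree {𝕜 σ : Type*} [Field 𝕜] {D D' : ℕ}
    {p q : MvPolynomial σ 𝕜} (hp : p ∈ restrictDegree σ 𝕜 D) (hq : q ∈ restrictDegree σ 𝕜 D') :
    p * q ∈ restrictDegree σ 𝕜 (D + D') := by
  classical
  rw [mem_restrictDegree] at *
  intro s hs i
  obtain ⟨a, ha, b, hb, rfl⟩ := Finset.mem_add.1 (support_mul p q hs)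
  exact add_le_add (hp a ha i) (hq b hb i)

lemma MvPolynomial.exists_mem_restrictDegree {𝕜 σ ι : Type*} [Field 𝕜] [Finite ι]
    (p : ι → MvPolynomial σ 𝕜) : ∃ D, ∀ i, p i ∈ restrictDegree σ 𝕜 D := by
  have := Fintype.ofFinite ι
  refine ⟨∑ i, (p i).totalDegree, fun i => ?_⟩
  have h := restrictTotalDegree_le_restrictDegree (R := 𝕜) σ (∑ i, (p i).totalDegree)
  refine h ((mem_restrictTotalDegree _ _ _).2 ?_)
  exact single_le_sum (f := fun i => (p i).totalDegree) (fun _ _ => Nat.zero_le _) (mem_univ i)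

variable {𝕜 K E : Type*} [Field 𝕜] [Field K] [Field E] [Algebra 𝕜 K] [Algebra K E] [Algebra 𝕜 E]
  [IsScalarTower 𝕜 K E] {n : ℕ} [Algebra (MvPolynomial (Fin n) 𝕜) K]
  [IsScalarTower 𝕜 (MvPolynomial (Fin n) 𝕜) K]

/-- The combinations of the elements `e l` with polynomial coefficients of degree at most `D` in
each variable. -/
noncomputable def polynomialCombination (n : ℕ) [Algebra (MvPolynomial (Fin n) 𝕜) K]
    [IsScalarTower 𝕜 (MvPolynomial (Fin n) 𝕜) K] {ι : Type*} [Fintype ι] (e : ι → E) (D : ℕ) :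
    (ι → MvPolynomial.restrictDegree (Fin n) 𝕜 D) →ₗ[𝕜] E where
  toFun p := ∑ l, algebraMap K E (algebraMap _ K (p l : MvPolynomial (Fin n) 𝕜)) * e l
  map_add' p q := by
    simp only [Pi.add_apply, Submodule.coe_add, map_add, add_mul, sum_add_distrib]
  map_smul' c p := by
    simp only [Pi.smul_apply, Submodule.coe_smul, RingHom.id_apply, smul_sum]
    refine sum_congr rfl fun l _ => ?_
    rw [Algebra.smul_def, map_mul, map_mul, ← IsScalarTower.algebraMap_apply 𝕜 _ K,
      ← IsScalarTower.algebraMap_apply 𝕜 K E, mul_assoc, ← Algebra.smul_def]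

lemma mem_range_polynomialCombination {ι : Type*} [Fintype ι] {e : ι → E} {D : ℕ} {x : E} :
    x ∈ LinearMap.range (polynomialCombination (𝕜 := 𝕜) (K := K) n e D) ↔
      ∃ p : ι → MvPolynomial (Fin n) 𝕜, (∀ l, p l ∈ MvPolynomial.restrictDegree (Fin n) 𝕜 D) ∧
        ∑ l, algebraMap K E (algebraMap _ K (p l)) * e l = x := by
  constructor
  · rintro ⟨p, rfl⟩
    exact ⟨fun l => p l, fun l => (p l).2, rfl⟩
  · rintro ⟨p, hp, rfl⟩
    exact ⟨fun l => ⟨p l, hp l⟩, rfl⟩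

lemma mul_mem_range_polynomialCombination {ι : Type*} [Fintype ι] {e : ι → E} {D D' : ℕ} {a x : E}
    (hx : x ∈ LinearMap.range (polynomialCombination (𝕜 := 𝕜) (K := K) n e D))
    (ha : ∀ l, a * e l ∈ LinearMap.range (polynomialCombination (𝕜 := 𝕜) (K := K) n e D')) :
    x * a ∈ LinearMap.range (polynomialCombination (𝕜 := 𝕜) (K := K) n e (D + D')) := by
  simp only [mem_range_polynomialCombination] at ha
  choose r hr hra using ha
  obtain ⟨p, hp, rfl⟩ := mem_range_polynomialCombination.1 hx
  refine mem_range_polynomialCombination.2 ⟨fun l' => ∑ l, p l * r l l', fun l' =>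
    Submodule.sum_mem _ fun l _ => MvPolynomial.mul_mem_restrictDegree (hp l) (hr l l'), ?_⟩
  simp_rw [map_sum, map_mul, sum_mul]
  rw [sum_comm]
  refine sum_congr rfl fun l _ => ?_
  rw [mul_assoc, mul_comm (e l), ← hra, mul_sum]
  simp_rw [mul_assoc]

/-- `q` is a common denominator of the coordinates of all the `z j`. -/
lemma exists_mul_mem_range_polynomialCombination [IsFractionRing (MvPolynomial (Fin n) 𝕜) K]
    {ι κ : Type*} [Fintype ι] [Finite κ] (e : Basis ι K E) (z : κ → E) :
    ∃ q : E, q ≠ 0 ∧ ∃ D, ∀ j,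
      q * z j ∈ LinearMap.range (polynomialCombination (𝕜 := 𝕜) (K := K) n e D) := by
  obtain ⟨⟨q, hq⟩, h⟩ := IsLocalization.exist_integer_multiples_of_finite
    (nonZeroDivisors (MvPolynomial (Fin n) 𝕜)) fun x : κ × ι => e.repr (z x.1) x.2
  choose p hp using h
  obtain ⟨D, hD⟩ := MvPolynomial.exists_mem_restrictDegree p
  refine ⟨algebraMap K E (algebraMap _ K q), ?_, D, fun j =>
    mem_range_polynomialCombination.2 ⟨fun l => p (j, l), fun l => hD _, ?_⟩⟩
  · rw [ne_eq, map_eq_zero]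
    exact IsFractionRing.to_map_ne_zero_of_mem_nonZeroDivisors hq
  · conv_rhs => rw [← e.sum_repr (z j), mul_sum]
    refine sum_congr rfl fun l _ => ?_
    rw [hp, Algebra.smul_def, Algebra.smul_def, map_mul, mul_assoc]

/-- The Hilbert function of `A_N` is `O(mⁿ)`, where `n` is the transcendence degree of the field. -/
theorem exists_finrank_pow_le [IsFractionRing (MvPolynomial (Fin n) 𝕜) K] [FiniteDimensional K E]
    (N : Submodule 𝕜 E) [FiniteDimensional 𝕜 N] :
    ∃ C : ℝ, ∀ m : ℕ, 1 ≤ m → (finrank 𝕜 ↥(N ^ m) : ℝ) ≤ C * (m : ℝ) ^ n := by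
  let e := finBasis K E
  let b := finBasis 𝕜 N
  -- One denominator serves for all products `b j * e l`, and, through `none`, for `1`, from which
  -- the powers start.
  obtain ⟨q, hq, D, hD⟩ := exists_mul_mem_range_polynomialCombination (𝕜 := 𝕜) (n := n) e
    (fun j : Option (Fin (finrank 𝕜 N) × Fin (finrank K E)) =>
      j.elim 1 fun x => (b x.1 : E) * e x.2)
  have hN : ∀ a ∈ N, ∀ l, q * a * e l ∈
      LinearMap.range (polynomialCombination (𝕜 := 𝕜) (K := K) n e D) := fun a ha l => by
    have h1 : a = ∑ j, b.repr ⟨a, ha⟩ j • (b j : E) := by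
      have := congrArg N.subtype (b.sum_repr ⟨a, ha⟩)
      rw [map_sum] at this
      exact this.symm
    rw [h1, mul_sum, sum_mul]
    refine Submodule.sum_mem _ fun j _ => ?_
    rw [mul_smul_comm, smul_mul_assoc, mul_assoc]
    exact Submodule.smul_mem _ _ (hD (some (j, l)))
  -- Each factor from `N` costs one `q` and degree `D`; the additional `q` writes the initial `1` in
  -- terms of `e`.
  have hpow : ∀ m, ∀ x ∈ N ^ m, q ^ (m + 1) * x ∈
      LinearMap.range (polynomialCombination (𝕜 := 𝕜) (K := K) n e ((m + 1) * D)) := by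
    intro m
    induction m with
    | zero =>
      intro x hx
      rw [pow_zero, Submodule.mem_one] at hx
      obtain ⟨c, rfl⟩ := hx
      rw [zero_add, one_mul, pow_one, mul_comm, ← Algebra.smul_def, ← mul_one q]
      exact Submodule.smul_mem _ _ (hD none)
    | succ m ih =>
      intro x hx
      rw [pow_succ] at hx
      induction hx using Submodule.mul_induction_on' with
      | mem_mul_mem y hy a ha =>
        have h := mul_mem_range_polynomialCombination (ih y hy) (hN a ha)
        rw [show (m + 1 + 1) * D = (m + 1) * D + D by ring]
        convert h using 1
        ring
      | add x _ y _ hx hy =>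
        rw [mul_add]
        exact Submodule.add_mem _ hx hy
  refine ⟨finrank K E * (2 * D + 1) ^ n, fun m hm => ?_⟩
  have h1 : finrank 𝕜 ↥(N ^ m) ≤ finrank 𝕜
      (LinearMap.range (polynomialCombination (𝕜 := 𝕜) (K := K) n e ((m + 1) * D))) := by
    have hqm : q ^ (m + 1) ≠ 0 := pow_ne_zero _ hq
    have hinj : Function.Injective (LinearMap.mulLeft 𝕜 (q ^ (m + 1))) :=
      fun x y h => mul_left_cancel₀ hqm h
    rw [(Submodule.equivMapOfInjective _ hinj (N ^ m)).finrank_eq]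
    refine Submodule.finrank_mono ?_
    rintro _ ⟨x, hx, rfl⟩
    exact hpow m x hx
  have h2 : finrank 𝕜 ↥(N ^ m) ≤ finrank K E * ((m + 1) * D + 1) ^ n := by
    refine h1.trans ((LinearMap.finrank_range_le _).trans ?_)
    rw [Module.finrank_pi_fintype, sum_const, card_univ, Fintype.card_fin, smul_eq_mul]
    exact Nat.mul_le_mul_left _ (MvPolynomial.finrank_restrictDegree_le _ _ _)
  have h3 : (m + 1) * D + 1 ≤ (2 * D + 1) * m := by nlinarith
  calc (finrank 𝕜 ↥(N ^ m) : ℝ) ≤ ((finrank K E * ((2 * D + 1) * m) ^ n : ℕ) : ℝ) := by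
        exact_mod_cast h2.trans (Nat.mul_le_mul_left _ (Nat.pow_le_pow_left h3 n))
    _ = _ := by push_cast; rw [mul_pow, mul_assoc]

end Growth

end

/-! ### Brunn–Minkowski for graded families of subspaces -/

section

open Finset Module Filter Topology

section GradedFamilies

variable {𝕜 K E F : Type*} [Field 𝕜] [Field E] [Algebra 𝕜 E]

instance Submodule.finiteDimensional_pow (N : Submodule 𝕜 E) [FiniteDimensional 𝕜 N] (m : ℕ) :
    FiniteDimensional 𝕜 ↥(N ^ m) :=
  Module.Finite.iff_fg.2 ((Module.Finite.iff_fg.1 ‹_›).pow m)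

instance Submodule.finiteDimensional_mul (M N : Submodule 𝕜 E) [FiniteDimensional 𝕜 M]
    [FiniteDimensional 𝕜 N] : FiniteDimensional 𝕜 ↥(M * N) :=
  Module.Finite.iff_fg.2 ((Module.Finite.iff_fg.1 ‹_›).mul (Module.Finite.iff_fg.1 ‹_›))

namespace IsTrivialOver

variable {Γ₀ : Type*} [LinearOrderedCommGroupWithZero Γ₀] {v : Valuation E Γ₀}

/-- The weighted semigroup of values of a graded family of subspaces. -/
noncomputable def weightedSemigroup (hv : IsTrivialOver 𝕜 v)
    (hbdd : ∃ d, ∀ (L : Submodule 𝕜 E) [FiniteDimensional 𝕜 L] (γ : Γ₀ˣ),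
      finrank 𝕜 (hv.leaf L γ) ≤ d)
    (L : ℕ → Submodule 𝕜 E) [∀ m, FiniteDimensional 𝕜 (L m)]
    (hmul : ∀ i j, L i * L j ≤ L (i + j)) (start : ℕ) (hstart : ∀ m ≥ start, L m ≠ ⊥) :
    WeightedSemigroup (Additive Γ₀ˣ) where
  weight m := hv.leafDim (L m)
  weight_le_add {i j a} ha b := by
    obtain ⟨x, hx, hxa⟩ := hv.mem_support_leafDim.1 ha
    exact hv.leafDim_le_leafDim_add hxa
      (fun y hy => hmul i j (Submodule.mul_mem_mul hx hy)) b
  bounded := by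
    obtain ⟨d, hd⟩ := hbdd
    exact ⟨d, fun m a => hd (L m) a.toMul⟩
  start := start
  nonempty m hm := by
    obtain ⟨x, hx, hne⟩ := Submodule.exists_mem_ne_zero_of_ne_bot (hstart m hm)
    have hx0 : v x ≠ 0 := (map_ne_zero v).2 hne
    exact ⟨Additive.ofMul (Units.mk0 _ hx0), hv.mem_support_leafDim.2 ⟨x, hx, rfl⟩⟩

/-- If `f` has value `e` and `x ∈ L m` has value `a`, then `a + j • e` is the value of `x * f ^ j`,
which for `1 ≤ j ≤ m` lies in the `m`-th power of `N` times the span of `1` and `f`. The dimension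
of that power is `O(mⁿ)`. -/
lemma hasGrowth_weightedSemigroup (hv : IsTrivialOver 𝕜 v) (hsurj : Function.Surjective v)
    (hbdd : ∃ d, ∀ (L : Submodule 𝕜 E) [FiniteDimensional 𝕜 L] (γ : Γ₀ˣ),
      finrank 𝕜 (hv.leaf L γ) ≤ d) {n : ℕ}
    (hgrowth : ∀ (N : Submodule 𝕜 E) [FiniteDimensional 𝕜 N],
      ∃ C : ℝ, ∀ m : ℕ, 1 ≤ m → (finrank 𝕜 ↥(N ^ m) : ℝ) ≤ C * (m : ℝ) ^ n)
    (L : ℕ → Submodule 𝕜 E) [∀ m, FiniteDimensional 𝕜 (L m)]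
    (hmul : ∀ i j, L i * L j ≤ L (i + j)) (start : ℕ) (hstart : ∀ m ≥ start, L m ≠ ⊥)
    (N : Submodule 𝕜 E) [FiniteDimensional 𝕜 N] (hN : ∀ m ≥ 1, L m ≤ N ^ m) :
    (hv.weightedSemigroup hbdd L hmul start hstart).toLevelSemigroup.HasGrowth n := by
  classical
  intro e
  obtain ⟨f, hf⟩ := hsurj ((Additive.toMul e : Γ₀ˣ) : Γ₀)
  set P : Submodule 𝕜 E := Submodule.span 𝕜 {1, f} with hP
  have hPfin : FiniteDimensional 𝕜 P := FiniteDimensional.span_of_finite 𝕜 (Set.toFinite _)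
  obtain ⟨C, hC⟩ := hgrowth (N * P)
  -- Degree 0 is separate because `L 0` need not lie in `N ^ 0`; only `j = 0` occurs there.
  refine ⟨fun m => if m = 0 then (hv.leafDim (L 0)).support else
    (hv.leafDim ((N * P) ^ m)).support, C, fun m a ha j hj => ?_, fun m hm => ?_⟩
  · change a ∈ (hv.leafDim (L m)).support at ha
    rcases Nat.eq_zero_or_pos m with rfl | hm
    · obtain rfl : j = 0 := by omega
      simpa using ha
    · simp only [hm.ne', if_false]
      obtain ⟨x, hx, hxa⟩ := hv.mem_support_leafDim.1 ha
      refine hv.mem_support_leafDim.2 ⟨x * f ^ j, ?_, ?_⟩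
      · rw [mul_pow]
        refine Submodule.mul_mem_mul (hN m hm hx) ?_
        have h1 : (1 : E) ∈ P := Submodule.subset_span (by simp)
        have hfP : f ∈ P := Submodule.subset_span (by simp)
        have h := Submodule.mul_mem_mul (Submodule.pow_mem_pow P hfP j)
          (Submodule.pow_mem_pow P h1 (m - j))
        rwa [one_pow, mul_one, ← pow_add, Nat.add_sub_cancel' hj] at h
      · rw [map_mul, map_pow, hxa, hf, toMul_add, toMul_nsmul, Units.val_mul, Units.val_pow_eq_pow_val]
  · have hm0 : m ≠ 0 := by omega
    simp only [hm0, if_false]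
    exact le_trans (by exact_mod_cast hv.card_support_leafDim_le _) (hC m hm)

end IsTrivialOver

/-- Brunn–Minkowski for graded families of subspaces of a finite extension of a rational function
field. -/
theorem exists_growth_of_finite [Field K] [Algebra 𝕜 K] [Algebra K E] [IsScalarTower 𝕜 K E] {n : ℕ}
    (hn : n ≠ 0) [Algebra (MvPolynomial (Fin n) 𝕜) K]
    [IsFractionRing (MvPolynomial (Fin n) 𝕜) K] [IsScalarTower 𝕜 (MvPolynomial (Fin n) 𝕜) K]
    [FiniteDimensional K E]
    (L₁ L₂ : ℕ → Submodule 𝕜 E) [∀ m, FiniteDimensional 𝕜 (L₁ m)]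
    [∀ m, FiniteDimensional 𝕜 (L₂ m)] (hmul₁ : ∀ i j, L₁ i * L₁ j ≤ L₁ (i + j))
    (hmul₂ : ∀ i j, L₂ i * L₂ j ≤ L₂ (i + j)) (hstart₁ : ∃ s, ∀ m ≥ s, L₁ m ≠ ⊥)
    (hstart₂ : ∃ s, ∀ m ≥ s, L₂ m ≠ ⊥) (N₁ N₂ : Submodule 𝕜 E) [FiniteDimensional 𝕜 N₁]
    [FiniteDimensional 𝕜 N₂] (hN₁ : ∀ m ≥ 1, L₁ m ≤ N₁ ^ m) (hN₂ : ∀ m ≥ 1, L₂ m ≤ N₂ ^ m) :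
    ∃ ρ₁ ρ₂ ρ₃ : NNReal,
      Tendsto (fun m : ℕ => (finrank 𝕜 (L₁ m) : ℝ) / (m : ℝ) ^ n) atTop (𝓝 ρ₁) ∧
      Tendsto (fun m : ℕ => (finrank 𝕜 (L₂ m) : ℝ) / (m : ℝ) ^ n) atTop (𝓝 ρ₂) ∧
      Tendsto (fun m : ℕ => (finrank 𝕜 ↥(L₁ m * L₂ m) : ℝ) / (m : ℝ) ^ n) atTop (𝓝 ρ₃) ∧
      ρ₁ ^ (n : ℝ)⁻¹ + ρ₂ ^ (n : ℝ)⁻¹ ≤ ρ₃ ^ (n : ℝ)⁻¹ := by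
  obtain ⟨V, hV, hbdd, _, _, hrank⟩ := exists_valuation_finrank_leaf_le (𝕜 := 𝕜) (K := K) (E := E) n
  have hsurj := V.valuation_surjective
  have hgrowth : ∀ (N : Submodule 𝕜 E) [FiniteDimensional 𝕜 N],
      ∃ C : ℝ, ∀ m : ℕ, 1 ≤ m → (finrank 𝕜 ↥(N ^ m) : ℝ) ≤ C * (m : ℝ) ^ n :=
    fun N _ => exists_finrank_pow_le (K := K) N
  obtain ⟨s₁, hs₁⟩ := hstart₁
  obtain ⟨s₂, hs₂⟩ := hstart₂
  have hmul₃ : ∀ i j, (L₁ i * L₂ i) * (L₁ j * L₂ j) ≤ L₁ (i + j) * L₂ (i + j) := fun i j => by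
    rw [mul_mul_mul_comm]
    exact mul_le_mul' (hmul₁ i j) (hmul₂ i j)
  have hs₃ : ∀ m ≥ max s₁ s₂, L₁ m * L₂ m ≠ ⊥ := fun m hm h => by
    obtain ⟨x, hx, hx0⟩ := Submodule.exists_mem_ne_zero_of_ne_bot (hs₁ m (le_of_max_le_left hm))
    obtain ⟨y, hy, hy0⟩ := Submodule.exists_mem_ne_zero_of_ne_bot (hs₂ m (le_of_max_le_right hm))
    have := Submodule.mul_mem_mul hx hy
    rw [h, Submodule.mem_bot] at this
    exact mul_ne_zero hx0 hy0 this
  have hN₃ : ∀ m ≥ 1, L₁ m * L₂ m ≤ (N₁ * N₂) ^ m := fun m hm => by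
    rw [mul_pow]
    exact mul_le_mul' (hN₁ m hm) (hN₂ m hm)
  have key := WeightedSemigroup.exists_growth_and_rpow_add_rpow_le hn hrank
    (hV.weightedSemigroup hbdd L₁ hmul₁ s₁ hs₁) (hV.weightedSemigroup hbdd L₂ hmul₂ s₂ hs₂)
    (hV.weightedSemigroup hbdd (fun m => L₁ m * L₂ m) hmul₃ _ hs₃)
    (hV.hasGrowth_weightedSemigroup hsurj hbdd hgrowth L₁ hmul₁ s₁ hs₁ N₁ hN₁)
    (hV.hasGrowth_weightedSemigroup hsurj hbdd hgrowth L₂ hmul₂ s₂ hs₂ N₂ hN₂)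
    (hV.hasGrowth_weightedSemigroup hsurj hbdd hgrowth _ hmul₃ _ hs₃ (N₁ * N₂) hN₃)
    -- Multiplication by an element of `L₂ m` of value `b` carries `L₁ m` into the product.
    (fun m a b hb => by
      obtain ⟨y, hy, hyb⟩ := hV.mem_support_leafDim.1 hb
      rw [add_comm]
      refine hV.leafDim_le_leafDim_add hyb (fun x hx => ?_) a
      rw [mul_comm]
      exact Submodule.mul_mem_mul hx hy)
    (fun m a b ha => by
      obtain ⟨x, hx, hxa⟩ := hV.mem_support_leafDim.1 ha
      exact hV.leafDim_le_leafDim_add hxa (fun y hy => Submodule.mul_mem_mul hx hy) b)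
  have htotal : ∀ (L : ℕ → Submodule 𝕜 E) [∀ m, FiniteDimensional 𝕜 (L m)] hmul s hs m,
      (hV.weightedSemigroup hbdd L hmul s hs).total m = finrank 𝕜 (L m) :=
    fun L _ _ _ _ m => hV.sum_leafDim (L m)
  simpa only [htotal] using key

variable [Field F] [Algebra 𝕜 F]

/-- Brunn–Minkowski for graded families of subspaces of a field of transcendence degree `n`. -/
theorem exists_growth_of_trdeg {n : ℕ} (hn : n ≠ 0) (htr : Algebra.trdeg 𝕜 F = n)
    (L₁ L₂ : ℕ → Submodule 𝕜 F) (hmul₁ : ∀ i j, L₁ i * L₁ j ≤ L₁ (i + j))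
    (hmul₂ : ∀ i j, L₂ i * L₂ j ≤ L₂ (i + j)) (hstart₁ : ∃ s, ∀ m ≥ s, L₁ m ≠ ⊥)
    (hstart₂ : ∃ s, ∀ m ≥ s, L₂ m ≠ ⊥) (N₁ N₂ : Submodule 𝕜 F) [FiniteDimensional 𝕜 N₁]
    [FiniteDimensional 𝕜 N₂] (hN₁₀ : L₁ 0 ≤ N₁) (hN₂₀ : L₂ 0 ≤ N₂) (hN₁ : ∀ m ≥ 1, L₁ m ≤ N₁ ^ m)
    (hN₂ : ∀ m ≥ 1, L₂ m ≤ N₂ ^ m) :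
    ∃ ρ₁ ρ₂ ρ₃ : NNReal,
      Tendsto (fun m : ℕ => (finrank 𝕜 (L₁ m) : ℝ) / (m : ℝ) ^ n) atTop (𝓝 ρ₁) ∧
      Tendsto (fun m : ℕ => (finrank 𝕜 (L₂ m) : ℝ) / (m : ℝ) ^ n) atTop (𝓝 ρ₂) ∧
      Tendsto (fun m : ℕ => (finrank 𝕜 ↥(L₁ m * L₂ m) : ℝ) / (m : ℝ) ^ n) atTop (𝓝 ρ₃) ∧
      ρ₁ ^ (n : ℝ)⁻¹ + ρ₂ ^ (n : ℝ)⁻¹ ≤ ρ₃ ^ (n : ℝ)⁻¹ := by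
  obtain ⟨x, hx⟩ : ∃ x : Fin n → F, IsTranscendenceBasis 𝕜 x := by
    obtain ⟨s, hs⟩ := exists_isTranscendenceBasis 𝕜 F
    have hcard := hs.cardinalMk_eq_trdeg
    rw [htr] at hcard
    obtain ⟨e⟩ := Cardinal.mk_eq_nat_iff.1 hcard
    exact ⟨_, (hs.comp_equiv e.symm)⟩
  set K := IntermediateField.adjoin 𝕜 (Set.range x) with hK
  have hKalg : Algebra.IsAlgebraic K F := hx.isAlgebraic_field
  let φ := hx.1.aevalEquivField
  let _ : Algebra (MvPolynomial (Fin n) 𝕜) K :=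
    ((φ : FractionRing (MvPolynomial (Fin n) 𝕜) →+* K).comp (algebraMap _ _)).toAlgebra
  have : IsFractionRing (MvPolynomial (Fin n) 𝕜) K :=
    IsLocalization.isLocalization_of_algEquiv (nonZeroDivisors (MvPolynomial (Fin n) 𝕜))
      (AlgEquiv.ofRingEquiv (f := (φ : FractionRing (MvPolynomial (Fin n) 𝕜) ≃+* K)) fun _ => rfl)
  have : IsScalarTower 𝕜 (MvPolynomial (Fin n) 𝕜) K := IsScalarTower.of_algebraMap_eq fun c => by
    change algebraMap 𝕜 K c = φ (algebraMap _ _ (algebraMap 𝕜 (MvPolynomial (Fin n) 𝕜) c))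
    rw [← IsScalarTower.algebraMap_apply, AlgEquiv.commutes]
  obtain ⟨s, hs⟩ : (N₁ ⊔ N₂).FG := Module.Finite.iff_fg.1 inferInstance
  -- `F` is only algebraic over `K`. Adjoining generators of `N₁ ⊔ N₂` gives a finite extension that
  -- contains both families.
  set E := IntermediateField.adjoin K (s : Set F) with hE
  have hEfin : FiniteDimensional K E := IntermediateField.finiteDimensional_adjoin fun y _ =>
    (hKalg.isAlgebraic y).isIntegral
  let ι : E →ₐ[𝕜] F := E.val.restrictScalars 𝕜
  have hιinj : Function.Injective ι.toLinearMap := Subtype.val_injective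
  have hrange : N₁ ⊔ N₂ ≤ LinearMap.range ι.toLinearMap := by
    rw [← hs, Submodule.span_le]
    intro y hy
    exact ⟨⟨y, IntermediateField.subset_adjoin K _ hy⟩, rfl⟩
  have hmap : ∀ {N : Submodule 𝕜 F}, N ≤ LinearMap.range ι.toLinearMap →
      (N.comap ι.toLinearMap).map ι.toLinearMap = N := fun h => by
    rw [Submodule.map_comap_eq, inf_eq_right.2 h]
  have hfd : ∀ {N : Submodule 𝕜 F}, FiniteDimensional 𝕜 N →
      FiniteDimensional 𝕜 (N.comap ι.toLinearMap) := fun {N} _ =>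
    Module.Finite.of_injective ((ι.toLinearMap.restrict (p := N.comap ι.toLinearMap) (q := N)
      fun _ h => h)) fun a b h => Subtype.ext (hιinj (congrArg N.subtype h))
  have hpowr : ∀ {N : Submodule 𝕜 F}, N ≤ LinearMap.range ι.toLinearMap →
      ∀ m, N ^ m ≤ LinearMap.range ι.toLinearMap := fun {N} h m => by
    rw [← hmap h, ← Submodule.map_pow]
    exact LinearMap.map_le_range
  have hcomap : ∀ {M N P : Submodule 𝕜 F}, M ≤ LinearMap.range ι.toLinearMap →
      N ≤ LinearMap.range ι.toLinearMap → M * N ≤ P →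
      M.comap ι.toLinearMap * N.comap ι.toLinearMap ≤ P.comap ι.toLinearMap := by
    intro M N P hM hN h
    rw [← Submodule.map_le_iff_le_comap, Submodule.map_mul, hmap hM, hmap hN]
    exact h
  have main : ∀ (L : ℕ → Submodule 𝕜 F) (N : Submodule 𝕜 F), FiniteDimensional 𝕜 N →
      N ≤ N₁ ⊔ N₂ → L 0 ≤ N → (∀ m ≥ 1, L m ≤ N ^ m) → (∃ s, ∀ m ≥ s, L m ≠ ⊥) →
      (∀ m, L m ≤ LinearMap.range ι.toLinearMap) ∧
      (∀ m, FiniteDimensional 𝕜 ((L m).comap ι.toLinearMap)) ∧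
      (∃ s, ∀ m ≥ s, (L m).comap ι.toLinearMap ≠ ⊥) ∧
      ∀ m ≥ 1, (L m).comap ι.toLinearMap ≤ (N.comap ι.toLinearMap) ^ m := by
    intro L N hfin hle h0 h1 hst
    have hNr := hle.trans hrange
    have hr : ∀ m, L m ≤ LinearMap.range ι.toLinearMap := fun m => by
      rcases Nat.eq_zero_or_pos m with rfl | hm
      exacts [h0.trans hNr, (h1 m hm).trans (hpowr hNr m)]
    refine ⟨hr, fun m => hfd ?_, ?_, fun m hm => ?_⟩
    · rcases Nat.eq_zero_or_pos m with rfl | hm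
      exacts [Submodule.finiteDimensional_of_le h0, Submodule.finiteDimensional_of_le (h1 m hm)]
    · obtain ⟨s, hs⟩ := hst
      refine ⟨s, fun m hm h => hs m hm ?_⟩
      rw [← hmap (hr m), h, Submodule.map_bot]
    · rw [← Submodule.map_le_map_iff_of_injective hιinj, Submodule.map_pow, hmap hNr, hmap (hr m)]
      exact h1 m hm
  obtain ⟨hr₁, _, hst₁, hb₁⟩ := main L₁ N₁ ‹_› le_sup_left hN₁₀ hN₁ hstart₁
  obtain ⟨hr₂, _, hst₂, hb₂⟩ := main L₂ N₂ ‹_› le_sup_right hN₂₀ hN₂ hstart₂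
  have hfinrank : ∀ {M : Submodule 𝕜 F}, M ≤ LinearMap.range ι.toLinearMap →
      finrank 𝕜 (M.comap ι.toLinearMap) = finrank 𝕜 M := fun {M} h => by
    conv_rhs => rw [← hmap h]
    exact (Submodule.equivMapOfInjective _ hιinj _).finrank_eq
  have hmuleq : ∀ m, finrank 𝕜 ↥((L₁ m).comap ι.toLinearMap * (L₂ m).comap ι.toLinearMap) =
      finrank 𝕜 ↥(L₁ m * L₂ m) := fun m => by
    rw [(Submodule.equivMapOfInjective _ hιinj _).finrank_eq, Submodule.map_mul, hmap (hr₁ m),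
      hmap (hr₂ m)]
  have := hfd (N := N₁) ‹_›
  have := hfd (N := N₂) ‹_›
  have key := exists_growth_of_finite (K := K) hn (fun m => (L₁ m).comap ι.toLinearMap)
    (fun m => (L₂ m).comap ι.toLinearMap)
    (fun i j => hcomap (hr₁ i) (hr₁ j) (hmul₁ i j)) (fun i j => hcomap (hr₂ i) (hr₂ j) (hmul₂ i j))
    hst₁ hst₂ _ _ hb₁ hb₂
  simp only [hmuleq, hfinrank (hr₁ _), hfinrank (hr₂ _)] at key
  exact key

end GradedFamilies

end

/-! ### Graded subalgebras of `F[t]` -/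

section

open Finset Module Filter Topology

namespace GradedPoly

variable {𝕜 F : Type*} [Field 𝕜] [Field F] [Algebra 𝕜 F]

lemma mem_subspace {A : Subalgebra 𝕜 (Polynomial F)} {i : ℕ} {a : F} :
    a ∈ subspace (Subalgebra.toSubmodule A) i ↔ Polynomial.monomial i a ∈ A := Iff.rfl

lemma homogeneous_injective (i : ℕ) :
    Function.Injective (homogeneous 𝕜 i : F →ₗ[𝕜] Polynomial F) :=
  Polynomial.monomial_injective i

lemma component_eq_map (M : Submodule 𝕜 (Polynomial F)) (i : ℕ) :
    component M i = (subspace M i).map (homogeneous 𝕜 i) := by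
  rw [component, subspace, Submodule.map_comap_eq, inf_comm]

lemma hilbertFunction_eq_finrank (M : Submodule 𝕜 (Polynomial F)) (i : ℕ)
    [FiniteDimensional 𝕜 (subspace M i)] :
    hilbertFunction M i = (finrank 𝕜 (subspace M i) : ℕ∞) := by
  rw [hilbertFunction, component_eq_map,
    ← (Submodule.equivMapOfInjective _ (homogeneous_injective i) (subspace M i)).rank_eq,
    ← Module.finrank_eq_rank, Cardinal.toENat_nat]

lemma subspace_mul_le (A : Subalgebra 𝕜 (Polynomial F)) (i j : ℕ) :
    subspace (Subalgebra.toSubmodule A) i * subspace (Subalgebra.toSubmodule A) j ≤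
      subspace (Subalgebra.toSubmodule A) (i + j) := by
  refine Submodule.mul_le.2 fun x hx y hy => ?_
  rw [mem_subspace] at *
  rw [← Polynomial.monomial_mul_monomial]
  exact A.mul_mem hx hy

lemma subspace_componentwiseProduct (A₁ A₂ : Subalgebra 𝕜 (Polynomial F)) (i : ℕ) :
    subspace (Subalgebra.toSubmodule (componentwiseProduct A₁ A₂)) i =
      subspace (Subalgebra.toSubmodule A₁) i * subspace (Subalgebra.toSubmodule A₂) i := by
  ext a
  rw [mem_subspace]
  change (∀ j, (Polynomial.monomial i a).coeff j ∈ _) ↔ _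
  refine ⟨fun h => by simpa using h i, fun h j => ?_⟩
  rw [Polynomial.coeff_monomial]
  split_ifs with hij
  · exact hij ▸ h
  · exact Submodule.zero_mem _

/-- The Hilbert function of an algebra of almost integral type is bounded by that of some `A_N`. -/
lemma IsAlmostIntegralType.exists_subspace_le_pow {A : Subalgebra 𝕜 (Polynomial F)}
    (hA : IsAlmostIntegralType A) :
    ∃ N : Submodule 𝕜 F, FiniteDimensional 𝕜 N ∧ subspace (Subalgebra.toSubmodule A) 0 ≤ N ∧
      ∀ m ≥ 1, subspace (Subalgebra.toSubmodule A) m ≤ N ^ m := by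
  classical
  obtain ⟨-, A', ⟨-, L, -, hL, hLA, hfin⟩, hAA'⟩ := hA
  let _ : Algebra (powerAlgebra L) A' := (Subalgebra.inclusion hLA).toRingHom.toAlgebra
  have hfin' : Module.Finite (powerAlgebra L) A' := hfin
  obtain ⟨s, hs⟩ := hfin'.fg_top
  set T : Set F := insert 1 (⋃ f ∈ s, Set.range (f : Polynomial F).coeff) with hT
  have hTfin : T.Finite := by
    refine Set.Finite.insert _ (s.finite_toSet.biUnion fun f _ => ?_)
    refine ((((f : Polynomial F).support.image (f : Polynomial F).coeff) ∪
      {0}).finite_toSet).subset ?_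
    rintro _ ⟨i, rfl⟩
    by_cases h : (f : Polynomial F).coeff i = 0
    · simp [h]
    · simp only [coe_union, coe_image, Set.mem_union]
      exact .inl ⟨i, Polynomial.mem_support_iff.2 h, rfl⟩
  -- `P` contains `L`, the coefficients of the module generators, and `1`, so that its powers
  -- increase.
  set P : Submodule 𝕜 F := L ⊔ Submodule.span 𝕜 T with hP
  have hPspan : FiniteDimensional 𝕜 (Submodule.span 𝕜 T) := FiniteDimensional.span_of_finite 𝕜 hTfin
  have hPfin : FiniteDimensional 𝕜 P := inferInstance
  have hTP : T ⊆ P := fun x hx => le_sup_right (α := Submodule 𝕜 F) (Submodule.subset_span hx)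
  have h1P : (1 : Submodule 𝕜 F) ≤ P := Submodule.one_le.2 (hTP (Set.mem_insert _ _))
  have hmono : ∀ {i j}, i ≤ j → P ^ i ≤ P ^ j := fun h => pow_le_pow_right' h1P h
  -- A term of degree `i` has at most `i` factors from `L`, and one more from the coefficient of a
  -- generator.
  have hcoeff : ∀ f : A', ∀ i, (f : Polynomial F).coeff i ∈ P ^ (i + 1) := by
    intro f
    have hf : f ∈ Submodule.span (powerAlgebra L) (s : Set A') := by rw [hs]; trivial
    induction hf using Submodule.span_induction with
    | mem f hf =>
      intro i
      refine hmono (show 1 ≤ i + 1 by omega) ?_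
      rw [pow_one]
      exact hTP (Set.mem_insert_of_mem _ (Set.mem_biUnion hf ⟨i, rfl⟩))
    | zero => simp
    | add f g _ _ hf hg =>
      intro i
      exact Submodule.add_mem _ (hf i) (hg i)
    | smul c f _ hf =>
      intro i
      change ((c : Polynomial F) * (f : Polynomial F)).coeff i ∈ _
      rw [Polynomial.coeff_mul]
      refine Submodule.sum_mem _ fun x hx => ?_
      rw [← mem_antidiagonal.1 hx, add_assoc, pow_add]
      exact Submodule.mul_mem_mul (pow_le_pow_left' (le_sup_left : L ≤ P) _ (c.2 x.1)) (hf x.2)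
  -- For `m ≥ 1`, `P ^ (m + 1) ≤ P ^ (2 * m) = (P ^ 2) ^ m`; in degree 0, `P ≤ P ^ 2`.
  refine ⟨P ^ 2, inferInstance, fun a ha => ?_, fun m hm a ha => ?_⟩
  · have := hcoeff ⟨_, hAA' ha⟩ 0
    simp only [homogeneous, LinearMap.coe_restrictScalars, Polynomial.coeff_monomial_same] at this
    exact hmono (by omega) this
  · have := hcoeff ⟨_, hAA' ha⟩ m
    simp only [homogeneous, LinearMap.coe_restrictScalars, Polynomial.coeff_monomial_same] at this
    rw [← pow_mul]
    exact hmono (by omega) this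

/-- The degrees of non-zero components form a submonoid of `ℕ`, as `F` has no zero divisors. Index 1
means that their gcd is 1, and such a submonoid contains all large integers. -/
lemma exists_forall_ge_subspace_ne_bot {A : Subalgebra 𝕜 (Polynomial F)} (hA : levelIndex A = 1) :
    ∃ s, ∀ m ≥ s, subspace (Subalgebra.toSubmodule A) m ≠ ⊥ := by
  set T : Set ℕ := {i | component (Subalgebra.toSubmodule A) i ≠ ⊥} with hT
  have hmem : ∀ i, i ∈ T ↔ subspace (Subalgebra.toSubmodule A) i ≠ ⊥ := fun i => by
    rw [hT, Set.mem_ofPred_eq, component_eq_map, ne_eq, ne_eq, ← le_bot_iff,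
      Submodule.map_le_iff_le_comap, Submodule.comap_bot,
      LinearMap.ker_eq_bot.2 (homogeneous_injective i), le_bot_iff]
  let S : AddSubmonoid ℕ :=
    { carrier := T
      zero_mem' := by
        rw [hmem, Submodule.ne_bot_iff]
        exact ⟨1, A.one_mem, one_ne_zero⟩
      add_mem' := fun {i j} hi hj => by
        rw [hmem, Submodule.ne_bot_iff] at *
        obtain ⟨x, hx, hx0⟩ := hi
        obtain ⟨y, hy, hy0⟩ := hj
        exact ⟨x * y, subspace_mul_le A i j (Submodule.mul_mem_mul hx hy), mul_ne_zero hx0 hy0⟩ }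
  have htop : AddSubgroup.closure ((fun i : ℕ => (i : ℤ)) '' T) = ⊤ := AddSubgroup.index_eq_one.1 hA
  have hone : (1 : ℤ) ∈ Ideal.span (((↑) : ℕ → ℤ) '' T) := by
    have hle : AddSubgroup.closure ((fun i : ℕ => (i : ℤ)) '' T) ≤
        (Ideal.span (((↑) : ℕ → ℤ) '' T)).toAddSubgroup :=
      (AddSubgroup.closure_le _).2 Ideal.subset_span
    exact hle (htop ▸ AddSubgroup.mem_top 1)
  rw [← Nat.span_singleton_setGcd, Ideal.mem_span_singleton] at hone
  have hgcd : Nat.setGcd T ∣ 1 := by exact_mod_cast hone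
  obtain ⟨s, hs⟩ := Nat.exists_mem_closure_of_ge T
  refine ⟨s, fun m hm => (hmem m).1 ?_⟩
  have hle : AddSubmonoid.closure T ≤ S := AddSubmonoid.closure_le.2 fun _ h => h
  exact hle (hs m hm (hgcd.trans (one_dvd m)))

lemma isGrowthCoefficient_of_tendsto {n : ℕ} {φ : ℕ → ℕ∞} {h : ℕ → ℕ} (hφ : ∀ i, φ i = h i)
    {ρ : NNReal} (hρ : Tendsto (fun m : ℕ => (h m : ℝ) / (m : ℝ) ^ n) atTop (𝓝 ρ)) :
    IsGrowthCoefficient n φ ρ := by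
  have h1 : Tendsto (fun m : ℕ => (h m : NNReal) / (m : NNReal) ^ n) atTop (𝓝 ρ) := by
    rw [← NNReal.tendsto_coe]
    simpa using hρ
  refine (ENNReal.tendsto_coe.2 h1).congr' ?_
  -- At `m = 0` the denominator may vanish, and division by zero differs between `NNReal` and
  -- `ENNReal`.
  filter_upwards [eventually_ge_atTop 1] with m hm
  have hm0 : (m : NNReal) ^ n ≠ 0 := pow_ne_zero _ (by exact_mod_cast (by omega : m ≠ 0))
  rw [ENNReal.coe_div hm0, hφ]
  simp

end GradedPoly

end

theorem mainTheorem6 {𝕜 F : Type*} [Field 𝕜] [Field F] [Algebra 𝕜 F]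
    (n : ℕ) (hn : 1 ≤ n) (htr : Algebra.trdeg 𝕜 F = n)
    (A₁ A₂ A₃ : Subalgebra 𝕜 (Polynomial F))
    (h₁ : GradedPoly.IsAlmostIntegralType A₁) (h₂ : GradedPoly.IsAlmostIntegralType A₂)
    (hm₁ : GradedPoly.levelIndex A₁ = 1) (hm₂ : GradedPoly.levelIndex A₂ = 1)
    (h₃ : A₃ = GradedPoly.componentwiseProduct A₁ A₂) :
    ∃ ρ₁ ρ₂ ρ₃ : NNReal,
      GradedPoly.IsGrowthCoefficient n
        (GradedPoly.hilbertFunction (Subalgebra.toSubmodule A₁)) ρ₁ ∧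
      GradedPoly.IsGrowthCoefficient n
        (GradedPoly.hilbertFunction (Subalgebra.toSubmodule A₂)) ρ₂ ∧
      GradedPoly.IsGrowthCoefficient n
        (GradedPoly.hilbertFunction (Subalgebra.toSubmodule A₃)) ρ₃ ∧
      ρ₁ ^ (1 / (n : ℝ)) + ρ₂ ^ (1 / (n : ℝ)) ≤ ρ₃ ^ (1 / (n : ℝ)) := by
  subst h₃
  obtain ⟨N₁, _, hN₁₀, hN₁⟩ := h₁.exists_subspace_le_pow
  obtain ⟨N₂, _, hN₂₀, hN₂⟩ := h₂.exists_subspace_le_pow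
  have hfin : ∀ (L : ℕ → Submodule 𝕜 F) (N : Submodule 𝕜 F), FiniteDimensional 𝕜 N →
      L 0 ≤ N → (∀ m ≥ 1, L m ≤ N ^ m) → ∀ m, FiniteDimensional 𝕜 (L m) :=
    fun L N _ h0 h m => by
      rcases Nat.eq_zero_or_pos m with rfl | hm
      exacts [Submodule.finiteDimensional_of_le h0, Submodule.finiteDimensional_of_le (h m hm)]
  have hf₁ := hfin _ N₁ ‹_› hN₁₀ hN₁
  have hf₂ := hfin _ N₂ ‹_› hN₂₀ hN₂
  obtain ⟨ρ₁, ρ₂, ρ₃, hρ₁, hρ₂, hρ₃, hle⟩ := exists_growth_of_trdeg (by omega) htr _ _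
    (GradedPoly.subspace_mul_le A₁) (GradedPoly.subspace_mul_le A₂)
    (GradedPoly.exists_forall_ge_subspace_ne_bot hm₁)
    (GradedPoly.exists_forall_ge_subspace_ne_bot hm₂) N₁ N₂ hN₁₀ hN₂₀ hN₁ hN₂
  refine ⟨ρ₁, ρ₂, ρ₃,
    GradedPoly.isGrowthCoefficient_of_tendsto
      (fun i => GradedPoly.hilbertFunction_eq_finrank _ i) hρ₁,
    GradedPoly.isGrowthCoefficient_of_tendsto
      (fun i => GradedPoly.hilbertFunction_eq_finrank _ i) hρ₂,
    GradedPoly.isGrowthCoefficient_of_tendsto (fun i => ?_) hρ₃, by simpa only [one_div] using hle⟩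
  have : FiniteDimensional 𝕜 (GradedPoly.subspace
      (Subalgebra.toSubmodule (GradedPoly.componentwiseProduct A₁ A₂)) i) := by
    rw [GradedPoly.subspace_componentwiseProduct]
    infer_instance
  rw [GradedPoly.hilbertFunction_eq_finrank, GradedPoly.subspace_componentwiseProduct]
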